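/- Let $p$ be a prime, $F$ a finite extension of $\mathbb{Q}_p$ with ring of integers $\mathfrak{o}$, uniformizer $\pi$, residue field $\kappa$ and normalized order $\mathrm{ord}$. **Gross–Keating invariant.** For a symmetric matrix $B=(b_{ij})$ over $F$ of size $n$, let $S(B)$ be the set of non-decreasing sequences $(a_1,\dots,a_n)$ of non-negative integers with $\mathrm{ord}(b_{ii})\ge a_i$ for all $i$ and $\mathrm{ord}(2b_{ij})\ge (a_i+a_j)/2$ for all $i\le j$. If $B$ is half-integral and non-degenerate, $\mathrm{GK}(B)$ is the lexicographically greatest element of $\bigcup_{U\in \mathrm{GL}_n(\mathfrak{o})}S({}^tUBU)$, and $B$ is *optimal* if $\mathrm{GK}(B)\in S(B)$. A quadratic lattice is a finitely generated free $\mathfrak{o}$-module $L$ with an $\mathfrak{o}$-valued ("integral") quadratic form $q_L$; its matrix in a basis $(e_i)$ has $b_{ii}=q_L(e_i)$ and $2b_{ij}=q_L(e_i+e_j)-q_L(e_i)-q_L(e_j)$, and $\mathrm{GK}(L)$ is $\mathrm{GK}$ of this matrix. A basis is optimal (reduced) if its matrix is optimal (reduced). **Reduced forms.** Let $a=(a_1,\dots,a_n)$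 be non-decreasing and let $\sigma\in\mathfrak{S}_n$ with $\sigma^2=1$. Put $\mathcal{P}^0=\{i: \sigma(i)=i\}$, $\mathcal{P}^+=\{i: a_i>a_{\sigma(i)}\}$, $\mathcal{P}^-=\{i: a_i<a_{\sigma(i)}\}$. The involution $\sigma$ is $a$-admissible if: (1) $\#\mathcal{P}^0\le 2$, and if $\mathcal{P}^0$ has two distinct elements $i,j$, then $a_i\not\equiv a_j \pmod 2$ and $a_i=\max\{a_k: k\in\mathcal{P}^0\cup\mathcal{P}^+,\ a_k\equiv a_i \pmod 2\}$ (and likewise for $j$); (2) for every value $c$, with $I=\{i: a_i=c\}$, one has $\#(I\cap\mathcal{P}^+)\le 1$ and $\#(I\cap\mathcal{P}^-)+\#(I\cap\mathcal{P}^0)\le 1$; (3) if $i\in\mathcal{P}^-$ then $a_{\sigma(i)}=\min\{a_j: j\in\mathcal{P}^+, a_j>a_i, a_j\equiv a_i \pmod 2\}$, and if $i\in\mathcal{P}^+$ then $a_{\sigma(i)}=\max\{a_j: j\in\mathcal{P}^-, a_j<a_i, a_j\equiv a_i \pmod 2\}$. The matrix $B$ is a reduced form of GK-type $(a,\sigma)$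 if $a\in S(B)$, $\sigma$ is $a$-admissible, and: $\mathrm{GK}\begin{pmatrix}b_{ii}&b_{ij}\\ b_{ij}&b_{jj}\end{pmatrix}=(a_i,a_j)$ whenever $i\notin\mathcal{P}^0$, $j=\sigma(i)$, $a_i\le a_j$; $\mathrm{ord}(b_{ii})=a_i$ for $i\in\mathcal{P}^0$; and $\mathrm{ord}(2b_{ij})>(a_i+a_j)/2$ for $j\ne i,\sigma(i)$. **Setting.** Let $L$ be a quadratic lattice of rank $n$ whose quadratic space $L\otimes F$ is non-degenerate, with $\mathrm{GK}(L)=(a_1,\dots,a_n)\ne(0,\dots,0)$, and let $(e_1,\dots,e_n)$ be a basis of $L$ that is optimal if $p$ is odd and reduced (of some GK-type $(\mathrm{GK}(L),\sigma)$) if $p=2$. Let $d\ge 1$ be such that $a_{n-d}<a_{n-d+1}=\dots=a_n$ (with $d=n$ if all $a_i$ are equal), and write $L=M\oplus N$, where $M$ is spanned by $e_1,\dots,e_{n-d}$ and $N$ by $e_{n-d+1},\dots,e_n$. **Statement.** Assume that either * $p$ is odd ($F$ an arbitrary finite extension of $\mathbb{Q}_p$), or * $F=\mathbb{Q}_p$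 with $p$ an arbitrary prime, and $L$ is anisotropic, i.e. $q_L(x)\neq 0$ for all nonzero $x\in L$. Let $M'$ be any $\mathfrak{o}$-lattice in $M\otimes F$ containing $M$, put $L'=M'\oplus N$, and let $q_{M'}$, $q_{L'}$ be the forms obtained by extending $q_L$ to $L\otimes F$ and restricting. Then $q_{L'}$ is integral if and only if $q_{M'}$ is integral. In this case the quadratic spaces $L'/\pi L'$ and $M'/\pi M'$ over $\kappa$ (with $q_{L'}$ and $q_{M'}$ taken modulo $\pi$) have the same dimension modulo their radicals, the radical of a quadratic form consisting of the vectors orthogonal to all vectors at which the form also vanishes; and the number of $0$'s in $\mathrm{GK}(L')$ equals the number of $0$'s in $\mathrm{GK}(M')$. -/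

import Mathlib

namespace GrossKeating

open Module

/-! ### The ring of integers of a finite extension of `ℚ_[p]` is a discrete valuation ring -/

section RingOfIntegers

variable (p : ℕ) [Fact p.Prime] (F : Type*) [Field F] [Algebra ℚ_[p] F]
  [FiniteDimensional ℚ_[p] F] [Algebra ℤ_[p] F] [IsScalarTower ℤ_[p] ℚ_[p] F]

theorem isIntegral_iff_spectralNorm_le_one (x : F) :
    IsIntegral ℤ_[p] x ↔ spectralNorm ℚ_[p] F x ≤ 1 := by
  have hx : IsIntegral ℚ_[p] x := Algebra.IsIntegral.isIntegral x
  rw [spectralNorm, spectralValue_le_one_iff (minpoly.monic hx)]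
  constructor
  · intro h n
    rw [minpoly.isIntegrallyClosed_eq_field_fractions' ℚ_[p] h, Polynomial.coeff_map]
    exact PadicInt.norm_le_one _
  · intro h
    have hl : minpoly ℚ_[p] x ∈ Polynomial.lifts (algebraMap ℤ_[p] ℚ_[p]) := by
      rw [Polynomial.lifts_iff_coeff_lifts]
      intro n
      exact ⟨⟨_, h n⟩, rfl⟩
    obtain ⟨q, hq, -, hm⟩ := Polynomial.lifts_and_natDegree_eq_and_monic hl (minpoly.monic hx)
    refine ⟨q, hm, ?_⟩
    rw [IsScalarTower.algebraMap_eq ℤ_[p] ℚ_[p] F, ← Polynomial.eval₂_map, hq]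
    exact minpoly.aeval _ _

instance isDiscreteValuationRing_integralClosure :
    IsDiscreteValuationRing (integralClosure ℤ_[p] F) := by
  have hval : ∀ x : F, x ∈ integralClosure ℤ_[p] F ∨ x⁻¹ ∈ integralClosure ℤ_[p] F := by
    intro x
    simp only [mem_integralClosure_iff, isIntegral_iff_spectralNorm_le_one]
    rcases eq_or_ne x 0 with rfl | hx
    · left; rw [spectralNorm_zero]; exact zero_le_one
    · have h1 : spectralNorm ℚ_[p] F x * spectralNorm ℚ_[p] F x⁻¹ = 1 := by
        have := map_mul (spectralMulAlgNorm ℚ_[p] F) x x⁻¹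
        rw [mul_inv_cancel₀ hx] at this
        simp only [spectralMulAlgNorm_def, spectralNorm_one] at this
        exact this.symm
      by_contra! hcon
      nlinarith [hcon.1, hcon.2]
  have : IsDedekindDomain (integralClosure ℤ_[p] F) :=
    integralClosure.isDedekindDomain ℤ_[p] ℚ_[p] F
  have hloc : IsLocalRing
      (ValuationSubring.ofSubring (integralClosure ℤ_[p] F).toSubring hval) := inferInstance
  have : IsLocalRing (integralClosure ℤ_[p] F) := hloc
  have hfield : ¬ IsField (integralClosure ℤ_[p] F) := by
    intro h
    have hinj : Function.Injective (algebraMap ℤ_[p] F) := by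
      rw [IsScalarTower.algebraMap_eq ℤ_[p] ℚ_[p] F]
      exact (algebraMap ℚ_[p] F).injective.comp (IsFractionRing.injective ℤ_[p] ℚ_[p])
    have hinj' : Function.Injective (algebraMap ℤ_[p] (integralClosure ℤ_[p] F)) := by
      intro x y hxy
      exact hinj (congrArg Subtype.val hxy)
    exact IsDiscreteValuationRing.not_isField ℤ_[p]
      (isField_of_isIntegral_of_isField hinj' h)
  have htfae := (IsDiscreteValuationRing.TFAE (integralClosure ℤ_[p] F) hfield).out 0 2
  exact htfae.mpr ‹IsDedekindDomain (integralClosure ℤ_[p] F)›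

instance isFractionRing_integralClosure : IsFractionRing (integralClosure ℤ_[p] F) F :=
  integralClosure.isFractionRing_of_finite_extension ℚ_[p] F

end RingOfIntegers

/-! ### Half-integral symmetric matrices and the Gross-Keating invariant -/

section Matrices

variable (o : Type*) [CommRing o] [IsDomain o] [IsDiscreteValuationRing o]
  {F : Type*} [Field F] [Algebra o F] [IsFractionRing o F]

open Classical in
/-- The normalized exponential order `ord` on the fraction field `F` of the discrete valuation
ring `o`, with `ord 0 = ⊤`. -/
noncomputable def ord (x : F) : WithTop ℤ :=
  if x = 0 then ⊤
  else ((-WithZero.log ((IsDiscreteValuationRing.maximalIdeal o).valuation F x) : ℤ) : WithTop ℤ)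

/-- The set `S(B)` of non-decreasing sequences `a` of non-negative integers with
`ord (b_ii) ≥ a_i` and `ord (2 b_ij) ≥ (a_i + a_j) / 2` for `i ≤ j`
(the second inequality is multiplied by `2`). -/
def admissibleSeqs {n : ℕ} (B : Matrix (Fin n) (Fin n) F) : Set (Fin n → ℕ) :=
  {a | Monotone a ∧ (∀ i, ((a i : ℤ) : WithTop ℤ) ≤ ord o (B i i)) ∧
    ∀ i j, i ≤ j → ((a i + a j : ℤ) : WithTop ℤ) ≤ ord o (2 * B i j) + ord o (2 * B i j)}

/-- `B[U] = ᵗU B U` for `U ∈ GL_n(o)`. -/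
def conjBy {n : ℕ} (B : Matrix (Fin n) (Fin n) F) (U : GL (Fin n) o) : Matrix (Fin n) (Fin n) F :=
  (U.val.map (algebraMap o F)).transpose * B * U.val.map (algebraMap o F)

/-- `a = GK(B)`: `a` is the greatest element, for the lexicographic order, of the union of the
sets `S(B[U])` over `U ∈ GL_n(o)`. -/
def HasGK {n : ℕ} (B : Matrix (Fin n) (Fin n) F) (a : Fin n → ℕ) : Prop :=
  (∃ U : GL (Fin n) o, a ∈ admissibleSeqs o (conjBy o B U)) ∧
    ∀ (U : GL (Fin n) o) (b : Fin n → ℕ), b ∈ admissibleSeqs o (conjBy o B U) →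
      toLex b ≤ toLex a

/-- `B` is optimal with Gross-Keating invariant `a`: `GK(B) = a` and `a ∈ S(B)`. -/
def IsOptimal {n : ℕ} (B : Matrix (Fin n) (Fin n) F) (a : Fin n → ℕ) : Prop :=
  HasGK o B a ∧ a ∈ admissibleSeqs o B

/-- `i ∈ 𝒫⁰(σ)`. -/
def PZero {n : ℕ} (σ : Equiv.Perm (Fin n)) : Set (Fin n) := {i | i = σ i}

/-- `i ∈ 𝒫⁺(σ)`. -/
def PPlus {n : ℕ} (a : Fin n → ℕ) (σ : Equiv.Perm (Fin n)) : Set (Fin n) := {i | a (σ i) < a i}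

/-- `i ∈ 𝒫⁻(σ)`. -/
def PMinus {n : ℕ} (a : Fin n → ℕ) (σ : Equiv.Perm (Fin n)) : Set (Fin n) := {i | a i < a (σ i)}

/-- `a`-admissible involutions. The blocks `I_s` are the fibres `{i | a i = c}`. -/
structure IsAdmissibleInvolution {n : ℕ} (a : Fin n → ℕ) (σ : Equiv.Perm (Fin n)) : Prop where
  involutive : ∀ i, σ (σ i) = i
  card_zero : (PZero σ).ncard ≤ 2
  zero_pair : ∀ i ∈ PZero σ, ∀ j ∈ PZero σ, i ≠ j → ¬ a i ≡ a j [MOD 2] ∧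
    IsGreatest (a '' {k | k ∈ PZero σ ∪ PPlus a σ ∧ a k ≡ a i [MOD 2]}) (a i)
  block_plus : ∀ c : ℕ, ({i | a i = c} ∩ PPlus a σ).ncard ≤ 1
  block_minus_zero : ∀ c : ℕ,
    ({i | a i = c} ∩ PMinus a σ).ncard + ({i | a i = c} ∩ PZero σ).ncard ≤ 1
  minus : ∀ i ∈ PMinus a σ,
    IsLeast (a '' {j | j ∈ PPlus a σ ∧ a i < a j ∧ a j ≡ a i [MOD 2]}) (a (σ i))
  plus : ∀ i ∈ PPlus a σ,
    IsGreatest (a '' {j | j ∈ PMinus a σ ∧ a j < a i ∧ a j ≡ a i [MOD 2]}) (a (σ i))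

/-- `B` is a reduced form of GK-type `(a, σ)`. -/
structure IsReducedForm {n : ℕ} (B : Matrix (Fin n) (Fin n) F) (a : Fin n → ℕ)
    (σ : Equiv.Perm (Fin n)) : Prop where
  mem : a ∈ admissibleSeqs o B
  admissible : IsAdmissibleInvolution a σ
  pair : ∀ i, i ∉ PZero σ → a i ≤ a (σ i) →
    HasGK o !![B i i, B i (σ i); B i (σ i), B (σ i) (σ i)] ![a i, a (σ i)]
  fixed : ∀ i ∈ PZero σ, ord o (B i i) = ((a i : ℤ) : WithTop ℤ)
  off : ∀ i j, j ≠ i → j ≠ σ i →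
    ((a i + a j : ℤ) : WithTop ℤ) < ord o (2 * B i j) + ord o (2 * B i j)

end Matrices

/-! ### Lattices in a quadratic space -/

section Lattices

variable (o : Type*) [CommRing o]
  {F : Type*} [Field F] [Algebra o F]
  {V : Type*} [AddCommGroup V] [Module F V] [Module o V]

/-- The symmetric matrix `B` of a quadratic form with respect to a family of vectors:
`b_ii = Q (v_i)` and `2 b_ij = Q (v_i + v_j) - Q (v_i) - Q (v_j)`. -/
def gram (Q : QuadraticForm F V) {ι : Type*} (v : ι → V) : Matrix ι ι F :=
  Matrix.of fun i j => QuadraticMap.polar Q (v i) (v j) / 2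

/-- The form `Q` takes values in `o` on the lattice `Λ`. -/
def IsIntegralOn (Q : QuadraticForm F V) (Λ : Submodule o V) : Prop :=
  ∀ x ∈ Λ, Q x ∈ Set.range (algebraMap o F)

/-- `GK(Λ) = a` for a lattice `Λ` of rank `r`, read off from the matrix of a basis of `Λ`. -/
def LatticeHasGK [IsDomain o] [IsDiscreteValuationRing o] [IsFractionRing o F]
    (Q : QuadraticForm F V) (Λ : Submodule o V) {r : ℕ} (a : Fin r → ℕ) : Prop :=
  ∃ v : Basis (Fin r) o Λ, HasGK o (gram Q fun i => (v i : V)) a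

/-- The `o`-valued function underlying `q_Λ`. -/
noncomputable def integralFun {Q : QuadraticForm F V} {Λ : Submodule o V}
    (h : IsIntegralOn o Q Λ) (x : Λ) : o := (h x x.2).choose

theorem algebraMap_integralFun {Q : QuadraticForm F V} {Λ : Submodule o V}
    (h : IsIntegralOn o Q Λ) (x : Λ) : algebraMap o F (integralFun o h x) = Q x :=
  (h x x.2).choose_spec

/-- The `o`-valued quadratic form `q_Λ` on a lattice `Λ` on which `Q` is integral. -/
noncomputable def integralForm [IsFractionRing o F] [IsScalarTower o F V]
    {Q : QuadraticForm F V} {Λ : Submodule o V}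
    (h : IsIntegralOn o Q Λ) : QuadraticForm o Λ :=
  QuadraticMap.ofPolar (integralFun o h)
    (by
      intro a x
      apply IsFractionRing.injective o F
      rw [algebraMap_integralFun, smul_eq_mul, map_mul, map_mul, algebraMap_integralFun,
        Submodule.coe_smul, ← algebraMap_smul F a (x : V), QuadraticMap.map_smul, smul_eq_mul])
    (by
      intro x y z
      apply IsFractionRing.injective o F
      have := QuadraticMap.polar_add_left Q (x : V) y z
      simp only [QuadraticMap.polar] at this ⊢
      simp only [map_sub, map_add, algebraMap_integralFun, Submodule.coe_add]
      exact this)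
    (by
      intro a x y
      apply IsFractionRing.injective o F
      have := QuadraticMap.polar_smul_left Q (algebraMap o F a) (x : V) y
      simp only [QuadraticMap.polar, algebraMap_smul, smul_eq_mul] at this ⊢
      simp only [map_sub, map_mul, algebraMap_integralFun, Submodule.coe_add,
        Submodule.coe_smul]
      exact this)

end Lattices

/-! ### Reduction of a quadratic form modulo the maximal ideal -/

section Reduction

variable {o : Type*} [CommRing o] [IsLocalRing o] {L : Type*} [AddCommGroup L] [Module o L]

open IsLocalRing (maximalIdeal)

theorem reduction_wd (q : QuadraticForm o L) {y : L}
    (hy : y ∈ (maximalIdeal o • ⊤ : Submodule o L)) :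
    q y ∈ maximalIdeal o ∧ ∀ x, QuadraticMap.polar q x y ∈ maximalIdeal o := by
  refine Submodule.smul_induction_on hy (fun r hr z hz => ?_) (fun y z hy hz => ?_)
  · refine ⟨?_, fun x => ?_⟩
    · rw [QuadraticMap.map_smul, smul_eq_mul]
      exact Ideal.mul_mem_right _ _ (Ideal.mul_mem_right _ _ hr)
    · rw [QuadraticMap.polar_smul_right, smul_eq_mul]
      exact Ideal.mul_mem_right _ _ hr
  · refine ⟨?_, fun x => ?_⟩
    · rw [QuadraticMap.map_add q]
      exact add_mem (add_mem hy.1 hz.1) (hz.2 y)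
    · rw [QuadraticMap.polar_add_right]
      exact add_mem (hy.2 x) (hz.2 x)

/-- The function underlying `q mod π` on `L / πL`. -/
def reductionFun (q : QuadraticForm o L) :
    L ⧸ (maximalIdeal o • ⊤ : Submodule o L) → o ⧸ maximalIdeal o :=
  Quotient.lift (fun x => Ideal.Quotient.mk (maximalIdeal o) (q x)) (by
    intro x y hxy
    have hm : y - x ∈ (maximalIdeal o • ⊤ : Submodule o L) := by
      rw [← neg_sub]
      exact neg_mem ((Submodule.quotientRel_def _).1 hxy)
    have h := reduction_wd q hm
    refine (Ideal.Quotient.eq.2 ?_).symm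
    have e : q y = q x + q (y - x) + QuadraticMap.polar q x (y - x) := by
      rw [← QuadraticMap.map_add q, add_sub_cancel]
    rw [e, add_assoc, add_sub_cancel_left]
    exact add_mem h.1 (h.2 x))

/-- The quadratic form `q mod π` on the `κ`-vector space `L / πL`, where `κ = o / π`. -/
def reduction (q : QuadraticForm o L) :
    QuadraticForm (o ⧸ maximalIdeal o) (L ⧸ (maximalIdeal o • ⊤ : Submodule o L)) :=
  QuadraticMap.ofPolar (reductionFun q)
    (by
      intro a x
      obtain ⟨a, rfl⟩ := Ideal.Quotient.mk_surjective a
      obtain ⟨x, rfl⟩ := Submodule.Quotient.mk_surjective _ x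
      change Ideal.Quotient.mk (maximalIdeal o) (q (a • x)) = _
      rw [QuadraticMap.map_smul, smul_eq_mul, map_mul, map_mul]
      rfl)
    (by
      intro x y z
      obtain ⟨x, rfl⟩ := Submodule.Quotient.mk_surjective _ x
      obtain ⟨y, rfl⟩ := Submodule.Quotient.mk_surjective _ y
      obtain ⟨z, rfl⟩ := Submodule.Quotient.mk_surjective _ z
      have h := congrArg (Ideal.Quotient.mk (maximalIdeal o)) (QuadraticMap.polar_add_left q x y z)
      simp only [QuadraticMap.polar, map_sub, map_add] at h
      exact h)
    (by
      intro a x y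
      obtain ⟨a, rfl⟩ := Ideal.Quotient.mk_surjective a
      obtain ⟨x, rfl⟩ := Submodule.Quotient.mk_surjective _ x
      obtain ⟨y, rfl⟩ := Submodule.Quotient.mk_surjective _ y
      have h := congrArg (Ideal.Quotient.mk (maximalIdeal o))
        (QuadraticMap.polar_smul_left q a x y)
      simp only [QuadraticMap.polar, map_sub, smul_eq_mul, map_mul] at h
      exact h)

/-- The dimension over `κ` of `L / πL` modulo the radical of `q mod π`. The radical of a quadratic
form consists of the vectors that are orthogonal to everything and at which the form vanishes. -/
noncomputable def dimModRadical (q : QuadraticForm o L) : ℕ :=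
  Module.finrank (o ⧸ maximalIdeal o)
    ((L ⧸ (maximalIdeal o • ⊤ : Submodule o L)) ⧸ (reduction q).radical)

end Reduction

/-! ### The assertion on overlattices -/

section Overlattices

variable (o : Type*) [CommRing o] [IsDomain o] [IsDiscreteValuationRing o]
  {F : Type*} [Field F] [Algebra o F] [IsFractionRing o F]
  {V : Type*} [AddCommGroup V] [Module F V] [Module o V] [IsScalarTower o F V]

/-- `L = o e_1 ⊕ ⋯ ⊕ o e_n` is a quadratic lattice in the nondegenerate quadratic space `(V, Q)`,
with `n = m + d`, `GK(L) = a ≠ (0, …, 0)`, and `d ≥ 1` is the number of entries of `a` equal to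
the last (largest) one: `a_m < a_{m+1} = ⋯ = a_{m+d}`. -/
structure IsLatticeWithLastBlock (Q : QuadraticForm F V) {m d : ℕ} (e : Basis (Fin (m + d)) F V)
    (a : Fin (m + d) → ℕ) : Prop where
  nondegenerate : Q.polarBilin.Nondegenerate
  integral : IsIntegralOn o Q (Submodule.span o (Set.range e))
  hasGK : HasGK o (gram Q e) a
  ne_zero : a ≠ 0
  d_pos : 0 < d
  last_eq : ∀ i j : Fin d, a (Fin.natAdd m i) = a (Fin.natAdd m j)
  lt_last : ∀ (i : Fin m) (j : Fin d), a (Fin.castAdd d i) < a (Fin.natAdd m j)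

/-- `M' ⊇ M` is an `o`-lattice in `M ⊗ F`, where `M` is the `o`-span of the first `m` vectors. -/
structure IsOverlattice {m d : ℕ} (e : Basis (Fin (m + d)) F V) (M' : Submodule o V) : Prop where
  fg : M'.FG
  le : Submodule.span o (Set.range fun i : Fin m => e (Fin.castAdd d i)) ≤ M'
  le_span : ∀ x ∈ M', x ∈ Submodule.span F (Set.range fun i : Fin m => e (Fin.castAdd d i))

/-- `L' = M' ⊕ N`, where `N` is the `o`-span of the last `d` vectors. -/
def extendByN {m d : ℕ} (e : Basis (Fin (m + d)) F V) (M' : Submodule o V) : Submodule o V :=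
  M' ⊔ Submodule.span o (Set.range fun j : Fin d => e (Fin.natAdd m j))

/-- For every overlattice `M'` of `M`, `q_{M'}` is integral if and only if `q_{L'}` is, and then
`L' / πL'` and `M' / πM'` have the same dimension modulo the radical, and `GK(L')` and `GK(M')`
have the same number of zeros. -/
def OverlatticeProperty (Q : QuadraticForm F V) {m d : ℕ} (e : Basis (Fin (m + d)) F V) : Prop :=
  ∀ M' : Submodule o V, IsOverlattice o e M' →
    (IsIntegralOn o Q M' ↔ IsIntegralOn o Q (extendByN o e M')) ∧
    ∀ (hM : IsIntegralOn o Q M') (hL : IsIntegralOn o Q (extendByN o e M')),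
      dimModRadical (integralForm o hL) = dimModRadical (integralForm o hM) ∧
      ∃ (g : Fin (m + d) → ℕ) (h : Fin m → ℕ),
        LatticeHasGK o Q (extendByN o e M') g ∧ LatticeHasGK o Q M' h ∧
        {i | g i = 0}.ncard = {i | h i = 0}.ncard

end Overlattices

end GrossKeating

/-!
The theorem holds because `M'` and `N` are orthogonal modulo `π` as soon as `Q` is integral on `M'`:
if `x ∈ M'` and `e_j` is a basis vector of `N`, then `(x, e_j) ∈ π o`, where `(x, y)` denotes the
polar form of `Q`. Since the last entry `c` of `GK(L)` is positive, also `Q(e_j) ∈ π o`. Hence `Q`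
is integral on `L' = M' ⊕ N`, and `N` lies in the radical of `L' / πL'`, so that `L'` and `M'` have
the same dimension modulo the radicals (`dimModRadical_eq_of_linearMap`,
`overlatticeProperty_of_polar`).

The number of zeros of a Gross-Keating invariant is always this dimension
(`ncard_zeros_eq_dimModRadical`). The invariants of `L'` and `M'` exist because the spaces are
nondegenerate and the determinant bounds the sum of an admissible sequence
(`exists_latticeHasGK`).

The orthogonality has two different reasons.

* If `2` is a unit, consider on `V` the weighted order `μ(x) = min_j (2 ord x_j + a_j)`. Optimality
  of the basis means that the form, rescaled by the weights, is nondegenerate modulo `π` on each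
  span of initial blocks; otherwise a basis vector could be exchanged so as to enlarge the
  sequence `a` lexicographically (`exists_not_halfOrdGE_polar`). So for `x ∈ M ⊗ F` some `e_i ∈ M`
  satisfies `2 ord (x, e_i) = μ(x) + a_i` (`exists_dominant_index`). If `x ∈ M'`, the left side is
  non-negative, so `μ(x) ≥ -a_i > -c`, and `2 ord (x, e_j) ≥ μ(x) + c > 0` for `e_j ∈ N`. The same
  lemma shows that `M ⊗ F` is nondegenerate.
* If `Q` is anisotropic over `ℚ_p`, Hensel's lemma gives `2 ord (x, y) ≥ ord Q(x) + ord Q(y)`, which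
  is positive for `x ∈ M'` and `y = e_j` (`halfOrdGE_polar_of_anisotropic`).
-/

namespace GrossKeating

open Module

/-! ### Orders on the fraction field -/

theorem two_ne_zero_of_isUnit {o : Type*} [CommRing o] (F : Type*) [Field F] [Algebra o F]
    (h2 : IsUnit (2 : o)) : (2 : F) ≠ 0 := by
  have := (h2.map (algebraMap o F)).ne_zero
  rwa [map_ofNat] at this

section Order

variable (o : Type*) [CommRing o] [IsDomain o] [IsDiscreteValuationRing o]
  {F : Type*} [Field F] [Algebra o F] [IsFractionRing o F]

theorem coe_le_ord_iff (c : ℤ) (x : F) : ((c : ℤ) : WithTop ℤ) ≤ ord o x ↔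
    (IsDiscreteValuationRing.maximalIdeal o).valuation F x ≤ WithZero.exp (-c) := by
  unfold ord
  split_ifs with h
  · simp [h]
  · have hv : (IsDiscreteValuationRing.maximalIdeal o).valuation F x ≠ 0 := by simpa using h
    rw [WithTop.coe_le_coe, ← WithZero.log_le_iff_le_exp hv]
    omega

/-- `2 ord x ≥ c`. Doubling avoids the half-integers `(a_i + a_j) / 2`. -/
def HalfOrdGE (c : ℤ) (x : F) : Prop := ((c : ℤ) : WithTop ℤ) ≤ ord o x + ord o x

theorem ord_mul (x y : F) : ord o (x * y) = ord o x + ord o y := by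
  unfold ord
  by_cases hx : x = 0
  · simp [hx]
  by_cases hy : y = 0
  · simp [hy]
  rw [if_neg (mul_ne_zero hx hy), if_neg hx, if_neg hy, map_mul,
    WithZero.log_mul (by simpa using hx) (by simpa using hy), ← WithTop.coe_add, neg_add]

theorem coe_le_ord_add {c : ℤ} {x y : F} (hx : (c : WithTop ℤ) ≤ ord o x)
    (hy : (c : WithTop ℤ) ≤ ord o y) : (c : WithTop ℤ) ≤ ord o (x + y) := by
  rw [coe_le_ord_iff] at *
  exact (Valuation.map_add _ x y).trans (max_le hx hy)

theorem ord_zero : ord o (0 : F) = ⊤ := by simp [ord]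

variable {o}

theorem exists_ord_eq {x : F} (hx : x ≠ 0) : ∃ k : ℤ, ord o x = k := by
  exact ⟨_, if_neg hx⟩

theorem ord_eq_zero_of_isUnit {u : o} (hu : IsUnit u) : ord o (algebraMap o F u) = 0 := by
  have h : algebraMap o F u ≠ 0 := (hu.map (algebraMap o F)).ne_zero
  have h2 : (IsDiscreteValuationRing.maximalIdeal o).valuation F (algebraMap o F u) = 1 := by
    rw [IsDedekindDomain.HeightOneSpectrum.valuation_eq_one_iff_notMem]
    intro h
    exact (IsLocalRing.mem_maximalIdeal u).1 h hu
  rw [ord, if_neg h, h2]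
  simp

theorem ord_inv_eq {x : F} {k : ℤ} (hx : x ≠ 0) (hk : ord o x = k) :
    ord o x⁻¹ = ((-k : ℤ) : WithTop ℤ) := by
  obtain ⟨r, hr⟩ := exists_ord_eq (o := o) (inv_ne_zero hx)
  have h1 := ord_mul o x x⁻¹
  have h2 := ord_eq_zero_of_isUnit (F := F) (isUnit_one (M := o))
  rw [map_one] at h2
  rw [mul_inv_cancel₀ hx, h2, hk, hr] at h1
  have h3 : (0 : ℤ) = k + r := by exact_mod_cast h1
  rw [hr, WithTop.coe_inj]
  omega

theorem zero_le_ord_iff {x : F} : 0 ≤ ord o x ↔ x ∈ Set.range (algebraMap o F) := by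
  have := coe_le_ord_iff o 0 x
  rw [WithTop.coe_zero] at this
  rw [this, neg_zero, WithZero.exp_zero]
  constructor
  · intro h
    obtain ⟨n, d, hd⟩ :=
      (IsDiscreteValuationRing.maximalIdeal o).exists_primeCompl_mul_eq_of_integer x h
    obtain ⟨u, hu⟩ : IsUnit (d : o) := by
      by_contra hd'
      exact d.2 ((IsLocalRing.mem_maximalIdeal _).2 hd')
    refine ⟨n * ↑u⁻¹, ?_⟩
    rw [map_mul, ← hd, ← hu, mul_assoc, ← map_mul, Units.mul_inv, map_one, mul_one]
  · rintro ⟨r, rfl⟩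
    exact IsDedekindDomain.HeightOneSpectrum.valuation_le_one _ r

theorem one_le_ord_iff {r : o} : 1 ≤ ord o (algebraMap o F r) ↔ r ∈ IsLocalRing.maximalIdeal o := by
  have := coe_le_ord_iff o 1 (algebraMap o F r)
  rw [WithTop.coe_one] at this
  rw [this, ← WithZero.lt_mul_exp_iff_le (by simp)]
  have h1 : (WithZero.exp (-1 : ℤ)) * WithZero.exp (1 : ℤ) = 1 := by
    rw [← WithZero.exp_add]; simp
  rw [h1]
  exact (IsDiscreteValuationRing.maximalIdeal o).valuation_lt_one_iff_mem r

namespace HalfOrdGE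

theorem zero (c : ℤ) : HalfOrdGE o c (0 : F) := by
  simp [HalfOrdGE, ord_zero]

theorem iff_of_ord {c k : ℤ} {x : F} (h : ord o x = k) : HalfOrdGE o c x ↔ c ≤ k + k := by
  rw [HalfOrdGE, h]; exact_mod_cast Iff.rfl

theorem mono {c c' : ℤ} {x : F} (h : HalfOrdGE o c x) (hc : c' ≤ c) : HalfOrdGE o c' x :=
  le_trans (by exact_mod_cast hc) h

/-- Orders are integers: the odd bound `2 ord x ≥ 2k - 1` is equivalent to `2 ord x ≥ 2k`. -/
theorem iff_of_ceil {c k : ℤ} {x : F} (h1 : c ≤ k + k) (h2 : k + k ≤ c + 1) :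
    HalfOrdGE o c x ↔ ((k : ℤ) : WithTop ℤ) ≤ ord o x := by
  by_cases hx : x = 0
  · simp [hx, ord_zero, zero]
  obtain ⟨l, hl⟩ := exists_ord_eq (o := o) hx
  rw [iff_of_ord hl, hl, WithTop.coe_le_coe]
  omega

theorem iff_ceil {c : ℤ} {x : F} :
    HalfOrdGE o c x ↔ (((c + 1) / 2 : ℤ) : WithTop ℤ) ≤ ord o x :=
  iff_of_ceil (by omega) (by omega)

theorem add {c : ℤ} {x y : F} (hx : HalfOrdGE o c x) (hy : HalfOrdGE o c y) :
    HalfOrdGE o c (x + y) := by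
  rw [iff_ceil] at *
  exact coe_le_ord_add o hx hy

theorem sum {ι : Type*} {s : Finset ι} {c : ℤ} {f : ι → F} (h : ∀ i ∈ s, HalfOrdGE o c (f i)) :
    HalfOrdGE o c (∑ i ∈ s, f i) :=
  Finset.sum_induction f _ (fun _ _ => add) (zero c) h

theorem mul {c c' : ℤ} {x y : F} (hx : HalfOrdGE o c x) (hy : HalfOrdGE o c' y) :
    HalfOrdGE o (c + c') (x * y) := by
  have := add_le_add hx hy
  rw [HalfOrdGE, ord_mul]
  push_cast
  convert this using 1
  abel

theorem prod {ι : Type*} {s : Finset ι} {c : ι → ℤ} {f : ι → F}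
    (h : ∀ i ∈ s, HalfOrdGE o (c i) (f i)) : HalfOrdGE o (∑ i ∈ s, c i) (∏ i ∈ s, f i) := by
  classical
  induction s using Finset.induction_on with
  | empty =>
    have := ord_eq_zero_of_isUnit (F := F) (isUnit_one (M := o))
    rw [map_one] at this
    simp [HalfOrdGE, this]
  | insert i s hi ih =>
    rw [Finset.sum_insert hi, Finset.prod_insert hi]
    exact (h i (by simp)).mul (ih fun j hj => h j (by simp [hj]))

theorem neg {c : ℤ} {x : F} (hx : HalfOrdGE o c x) : HalfOrdGE o c (-x) := by
  rw [iff_ceil, coe_le_ord_iff] at *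
  rwa [Valuation.map_neg]

theorem zero_iff {x : F} : HalfOrdGE o 0 x ↔ x ∈ Set.range (algebraMap o F) := by
  rw [iff_of_ceil (k := 0) (by omega) (by omega)]
  exact zero_le_ord_iff

theorem one_iff {r : o} :
    HalfOrdGE o 1 (algebraMap o F r) ↔ r ∈ IsLocalRing.maximalIdeal o := by
  rw [iff_of_ceil (k := 1) (by omega) (by omega)]
  exact one_le_ord_iff

end HalfOrdGE

end Order

/-! ### Bases, Gram matrices and existence of the Gross-Keating invariant -/

section ChangeOfBasis

variable (o : Type*) [CommRing o] {F : Type*} [Field F] [Algebra o F]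
  {V : Type*} [AddCommGroup V] [Module F V] [Module o V] [IsScalarTower o F V]

theorem conjBy_gram (Q : QuadraticForm F V) {n : ℕ} (v : Fin n → V) (U : GL (Fin n) o) :
    conjBy o (gram Q v) U = gram Q fun j => ∑ i, U.val i j • v i := by
  ext j k
  have h : ∀ x y, QuadraticMap.polar Q x y = QuadraticMap.polarBilin Q x y := fun _ _ => rfl
  simp only [conjBy, gram, Matrix.mul_apply, Matrix.of_apply, h, ← algebraMap_smul F (U.val _ _),
    map_sum, LinearMap.sum_apply, map_smul, LinearMap.smul_apply, smul_eq_mul,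
    Matrix.transpose_apply, Matrix.map_apply, Finset.sum_div, Finset.sum_mul, Finset.mul_sum]
  refine Finset.sum_congr rfl fun _ _ => Finset.sum_congr rfl fun _ _ => ?_
  ring

omit [IsScalarTower o F V] in
variable {o} in
theorem IsIntegralOn.polar [IsDomain o] [IsDiscreteValuationRing o] [IsFractionRing o F]
    {Q : QuadraticForm F V} {Λ : Submodule o V}
    (hΛ : IsIntegralOn o Q Λ) {x y : V} (hx : x ∈ Λ) (hy : y ∈ Λ) :
    HalfOrdGE o 0 (QuadraticMap.polar Q x y) := by
  rw [QuadraticMap.polar, sub_eq_add_neg, sub_eq_add_neg]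
  exact ((HalfOrdGE.zero_iff.2 (hΛ _ (add_mem hx hy))).add
    (HalfOrdGE.zero_iff.2 (hΛ _ hx)).neg).add (HalfOrdGE.zero_iff.2 (hΛ _ hy)).neg

end ChangeOfBasis

section Bases

variable (o : Type*) [CommRing o] [IsDomain o] [IsDiscreteValuationRing o]
  {F : Type*} [Field F] [Algebra o F] [IsFractionRing o F]
  {V : Type*} [AddCommGroup V] [Module F V]

theorem two_mul_gram_apply (h2 : (2 : F) ≠ 0) (Q : QuadraticForm F V) {ι : Type*} (v : ι → V)
    (i j : ι) : 2 * gram Q v i j = QuadraticMap.polar Q (v i) (v j) := by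
  rw [gram, Matrix.of_apply, mul_div_cancel₀ _ h2]

theorem gram_apply_self (h2 : (2 : F) ≠ 0) (Q : QuadraticForm F V) {ι : Type*} (v : ι → V)
    (i : ι) : gram Q v i i = Q (v i) := by
  rw [gram, Matrix.of_apply, QuadraticMap.polar_self, nsmul_eq_mul, Nat.cast_ofNat,
    mul_div_cancel_left₀ _ h2]

theorem mem_admissibleSeqs_gram_iff (h2 : (2 : F) ≠ 0) (Q : QuadraticForm F V) {n : ℕ}
    (v : Fin n → V) (a : Fin n → ℕ) : a ∈ admissibleSeqs o (gram Q v) ↔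
      Monotone a ∧ (∀ i, HalfOrdGE o (2 * a i) (Q (v i))) ∧
        ∀ i j, HalfOrdGE o (a i + a j) (QuadraticMap.polar Q (v i) (v j)) := by
  simp only [admissibleSeqs, Set.mem_ofPred_eq, two_mul_gram_apply h2, gram_apply_self h2]
  refine and_congr Iff.rfl (and_congr (forall_congr' fun i => ?_)
    ⟨fun h i j => ?_, fun h i j _ => h i j⟩)
  · rw [HalfOrdGE.iff_of_ceil (k := a i) (by omega) (by omega)]
  · rcases le_total i j with hij | hij
    · exact h i j hij
    · rw [QuadraticMap.polar_comm, add_comm]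
      exact h j i hij

variable [Module o V] [IsScalarTower o F V]

/-- Change of basis by `GL_n(o)` turned into a statement on all bases of the lattice. -/
theorem hasGK_gram_iff (Q : QuadraticForm F V) {Λ : Submodule o V} {n : ℕ}
    (v : Basis (Fin n) o Λ) (a : Fin n → ℕ) : HasGK o (gram Q fun i => (v i : V)) a ↔
      (∃ w : Basis (Fin n) o Λ, a ∈ admissibleSeqs o (gram Q fun i => (w i : V))) ∧
      ∀ (w : Basis (Fin n) o Λ) (b : Fin n → ℕ),
        b ∈ admissibleSeqs o (gram Q fun i => (w i : V)) → toLex b ≤ toLex a := by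
  have key1 : ∀ U : GL (Fin n) o, ∃ w : Basis (Fin n) o Λ,
      conjBy o (gram Q fun i => (v i : V)) U = gram Q fun i => (w i : V) := by
    intro U
    refine ⟨v.map (Matrix.toLinOfInv v v (M := U.val) (M' := U.inv) U.val_inv U.inv_val), ?_⟩
    rw [conjBy_gram]
    congr 1
    ext j
    simp only [Basis.map_apply, Matrix.toLinOfInv_apply, Matrix.toLin_self]
    simp
  have key2 : ∀ w : Basis (Fin n) o Λ, ∃ U : GL (Fin n) o,
      conjBy o (gram Q fun i => (v i : V)) U = gram Q fun i => (w i : V) := by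
    intro w
    refine ⟨⟨v.toMatrix w, w.toMatrix v, v.toMatrix_mul_toMatrix_flip w,
      w.toMatrix_mul_toMatrix_flip v⟩, ?_⟩
    rw [conjBy_gram]
    congr 1
    ext j
    have := congrArg Subtype.val (v.sum_toMatrix_smul_self w j)
    rwa [AddSubmonoidClass.coe_finsetSum] at this
  constructor
  · rintro ⟨⟨U, hU⟩, h⟩
    obtain ⟨w, hw⟩ := key1 U
    refine ⟨⟨w, hw ▸ hU⟩, fun w b hb => ?_⟩
    obtain ⟨U, hU⟩ := key2 w
    exact h U b (hU ▸ hb)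
  · rintro ⟨⟨w, hw⟩, h⟩
    obtain ⟨U, hU⟩ := key2 w
    refine ⟨⟨U, hU ▸ hw⟩, fun U b hb => ?_⟩
    obtain ⟨w, hw⟩ := key1 U
    exact h w b (hw ▸ hb)

/-- Existence of the Gross-Keating invariant. The Leibniz expansion of the determinant of the
polar matrix shows that it bounds the sum of every admissible sequence of every basis. -/
theorem exists_latticeHasGK (h2 : (2 : F) ≠ 0) (Q : QuadraticForm F V) {Λ : Submodule o V} {n : ℕ}
    (hΛ : IsIntegralOn o Q Λ) (v : Basis (Fin n) o Λ)
    (hv : (gram Q fun i => (v i : V)).det ≠ 0) : ∃ a : Fin n → ℕ, LatticeHasGK o Q Λ a := by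
  let B := gram Q fun i => (v i : V)
  have hdet : ((2 : F) • B).det ≠ 0 := by
    rw [Matrix.det_smul]
    exact mul_ne_zero (pow_ne_zero _ h2) hv
  obtain ⟨D, hD⟩ := exists_ord_eq (o := o) hdet
  let S : Set (Fin n → ℕ) := ⋃ U : GL (Fin n) o, admissibleSeqs o (conjBy o B U)
  have hbound : ∀ b ∈ S, ∑ i, (b i : ℤ) ≤ D := by
    intro b hb
    obtain ⟨U, hU⟩ := Set.mem_iUnion.1 hb
    have hUdet : ord o ((2 : F) • conjBy o B U).det = D := by
      have hu : IsUnit U.val.det := (Matrix.isUnit_iff_isUnit_det _).1 U.isUnit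
      have e : ((2 : F) • conjBy o B U).det =
          algebraMap o F U.val.det * (((2 : F) • B).det * algebraMap o F U.val.det) := by
        rw [conjBy, ← Matrix.smul_mul, ← Matrix.mul_smul, Matrix.det_mul, Matrix.det_mul,
          Matrix.det_transpose, ← RingHom.mapMatrix_apply, ← RingHom.map_det, mul_assoc]
      rw [e, ord_mul, ord_mul, ord_eq_zero_of_isUnit hu, hD, zero_add, add_zero]
    have hU' : ∀ i j, HalfOrdGE o (b i + b j) (((2 : F) • conjBy o B U) i j) := by
      intro i j
      rw [conjBy_gram] at hU ⊢
      rw [Matrix.smul_apply, smul_eq_mul, two_mul_gram_apply h2]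
      exact ((mem_admissibleSeqs_gram_iff o h2 Q _ _).1 hU).2.2 i j
    have : HalfOrdGE o (2 * ∑ i, (b i : ℤ)) ((2 : F) • conjBy o B U).det := by
      rw [Matrix.det_apply]
      refine HalfOrdGE.sum fun σ _ => ?_
      have hp : HalfOrdGE o (2 * ∑ i, (b i : ℤ)) (∏ i, ((2 : F) • conjBy o B U) (σ i) i) := by
        refine (HalfOrdGE.prod fun i _ => hU' (σ i) i).mono (le_of_eq ?_)
        rw [Finset.sum_add_distrib, Equiv.sum_comp σ fun i => (b i : ℤ), two_mul]
      rcases Int.units_eq_one_or (Equiv.Perm.sign σ) with h | h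
      · rwa [h, one_smul]
      · rw [h, Units.neg_smul, one_smul]
        exact hp.neg
    rw [HalfOrdGE.iff_of_ord hUdet] at this
    omega
  have hfin : S.Finite := by
    refine (Set.Finite.pi' fun _ : Fin n => Set.finite_Iic D.toNat).subset fun b hb i => ?_
    have h1 := hbound b hb
    have h3 := Finset.single_le_sum (f := fun i => (b i : ℤ)) (fun _ _ => by positivity)
      (Finset.mem_univ i)
    simp only [Set.mem_Iic] at h3 ⊢
    omega
  have hne : (0 : Fin n → ℕ) ∈ S := by
    refine Set.mem_iUnion.2 ⟨1, ?_⟩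
    have h1 : conjBy o B 1 = B := by simp [conjBy]
    rw [h1, mem_admissibleSeqs_gram_iff o h2]
    refine ⟨monotone_const, fun i => ?_, fun i j => ?_⟩
    · simpa using HalfOrdGE.zero_iff.2 (hΛ _ (v i).2)
    · simpa using hΛ.polar (v i).2 (v j).2
  obtain ⟨a, ha, hmax⟩ := Set.exists_max_image S toLex hfin ⟨0, hne⟩
  exact ⟨a, v, Set.mem_iUnion.1 ha, fun U b hb => hmax b (Set.mem_iUnion.2 ⟨U, hb⟩)⟩

end Bases

/-! ### The reduction modulo its radical -/

section Reduction

open IsLocalRing (maximalIdeal)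

variable {o : Type*} [CommRing o] [IsLocalRing o] {L : Type*} [AddCommGroup L] [Module o L]

theorem mk_mem_radical_reduction_iff (q : QuadraticForm o L) (x : L) :
    (Submodule.Quotient.mk x : L ⧸ (maximalIdeal o • ⊤ : Submodule o L)) ∈ (reduction q).radical ↔
      q x ∈ maximalIdeal o ∧ ∀ y, QuadraticMap.polar q x y ∈ maximalIdeal o := by
  have hpolar : ∀ y : L, QuadraticMap.polar (reduction q) (Submodule.Quotient.mk x)
      (Submodule.Quotient.mk y) =
        Ideal.Quotient.mk (maximalIdeal o) (QuadraticMap.polar q x y) := by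
    intro y
    simp only [QuadraticMap.polar, map_sub]
    rfl
  have hval : reduction q (Submodule.Quotient.mk x) =
      Ideal.Quotient.mk (maximalIdeal o) (q x) := rfl
  change _ = _ ∧ _ = _ ↔ _
  rw [hval, Ideal.Quotient.eq_zero_iff_mem, LinearMap.ext_iff]
  refine and_congr Iff.rfl ⟨fun h y => ?_, fun h y => ?_⟩
  · rw [← Ideal.Quotient.eq_zero_iff_mem, ← hpolar]
    exact h _
  · obtain ⟨y, rfl⟩ := Submodule.Quotient.mk_surjective _ y
    change QuadraticMap.polar _ _ _ = 0
    rw [hpolar, Ideal.Quotient.eq_zero_iff_mem]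
    exact h y

/-- The projection of `L` onto the `κ`-vector space `L / πL` modulo the radical of `q mod π`. -/
def toModRadical (q : QuadraticForm o L) :
    L →ₗ[o] (L ⧸ (maximalIdeal o • ⊤ : Submodule o L)) ⧸ (reduction q).radical :=
  ((reduction q).radical.mkQ.restrictScalars o).comp (Submodule.mkQ _)

theorem toModRadical_surjective (q : QuadraticForm o L) :
    Function.Surjective (toModRadical q) :=
  (Submodule.mkQ_surjective _).comp (Submodule.mkQ_surjective _)

theorem toModRadical_eq_zero_iff (q : QuadraticForm o L) (x : L) : toModRadical q x = 0 ↔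
    q x ∈ maximalIdeal o ∧ ∀ y, QuadraticMap.polar q x y ∈ maximalIdeal o := by
  rw [← mk_mem_radical_reduction_iff]
  exact Submodule.Quotient.mk_eq_zero _

theorem toModRadical_smul (q : QuadraticForm o L) (r : o) (x : L) :
    toModRadical q (r • x) = Ideal.Quotient.mk (maximalIdeal o) r • toModRadical q x := rfl

/-- An isometry `M → L` that is surjective up to vectors in the radical of `q mod π` induces an
isomorphism modulo the radicals. -/
theorem dimModRadical_eq_of_linearMap {M : Type*} [AddCommGroup M] [Module o M]
    (qL : QuadraticForm o L) (qM : QuadraticForm o M) (f : M →ₗ[o] L)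
    (hf : ∀ x, qL (f x) = qM x)
    (hsurj : ∀ y, ∃ x, toModRadical qL (y - f x) = 0) :
    dimModRadical qL = dimModRadical qM := by
  have hpol : ∀ x y, QuadraticMap.polar qL (f x) (f y) = QuadraticMap.polar qM x y := by
    intro x y
    simp only [QuadraticMap.polar, ← map_add, hf]
  let g := (toModRadical qL).comp f
  have hg : Function.Surjective g := by
    intro z
    obtain ⟨y, rfl⟩ := toModRadical_surjective qL z
    obtain ⟨x, hx⟩ := hsurj y
    rw [map_sub, sub_eq_zero] at hx
    exact ⟨x, hx.symm⟩
  have hker : g.ker = (toModRadical qM).ker := by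
    ext x
    rw [LinearMap.mem_ker, LinearMap.mem_ker, toModRadical_eq_zero_iff, LinearMap.comp_apply,
      toModRadical_eq_zero_iff, hf]
    refine and_congr Iff.rfl ⟨fun h y => hpol x y ▸ h (f y), fun h y => ?_⟩
    obtain ⟨x', hx'⟩ := hsurj y
    have e : y = (y - f x') + f x' := by abel
    rw [e, QuadraticMap.polar_add_right, hpol, QuadraticMap.polar_comm]
    exact add_mem (((toModRadical_eq_zero_iff _ _).1 hx').2 _) (h x')
  let E := ((g.quotKerEquivOfSurjective hg).symm.trans (Submodule.quotEquivOfEq _ _ hker)).trans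
    ((toModRadical qM).quotKerEquivOfSurjective (toModRadical_surjective qM))
  exact (E.extendScalarsOfSurjective (S := o ⧸ maximalIdeal o)
    Ideal.Quotient.mk_surjective).finrank_eq

theorem dimModRadical_le_card {ι : Type*} [Fintype ι] (q : QuadraticForm o L) (v : Basis ι o L)
    (T : Finset ι) (hT : ∀ j ∉ T, toModRadical q (v j) = 0) : dimModRadical q ≤ T.card := by
  rw [← Fintype.card_coe]
  refine finrank_le_of_span_eq_top (v := fun j : T => toModRadical q (v j)) (eq_top_iff.2 ?_)
  rintro z -
  obtain ⟨y, rfl⟩ := toModRadical_surjective q z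
  rw [← v.sum_repr y, map_sum]
  refine Submodule.sum_mem _ fun i _ => ?_
  rw [toModRadical_smul]
  refine Submodule.smul_mem _ _ ?_
  by_cases hi : i ∈ T
  · exact Submodule.subset_span ⟨⟨i, hi⟩, rfl⟩
  · rw [hT i hi]
    exact zero_mem _

/-- A lattice has a basis whose vectors from position `dimModRadical q` on lie in the radical
modulo `π`: lift a basis of `L / πL` adapted to the radical, by Nakayama's lemma. -/
theorem exists_basis_adapted_radical {n : ℕ} (q : QuadraticForm o L) (v : Basis (Fin n) o L) :
    dimModRadical q ≤ n ∧ ∃ w : Basis (Fin n) o L,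
      ∀ j : Fin n, dimModRadical q ≤ j → toModRadical q (w j) = 0 := by
  let : Field (o ⧸ maximalIdeal o) := Ideal.Quotient.field _
  have : Module.Finite o L := Module.Finite.of_basis v
  have : Module.Free o L := Module.Free.of_basis v
  let W := L ⧸ (maximalIdeal o • ⊤ : Submodule o L)
  have : Module.Finite (o ⧸ maximalIdeal o) W := Module.Finite.of_restrictScalars_finite o _ _
  let R := (reduction q).radical
  let bR : Basis (Fin (finrank (o ⧸ maximalIdeal o) R)) (o ⧸ maximalIdeal o) R := finBasis _ _
  let bQ : Basis (Fin (dimModRadical q)) (o ⧸ maximalIdeal o) (W ⧸ R) := finBasis _ _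
  have hn : finrank (o ⧸ maximalIdeal o) W = n := by
    rw [← ((TensorProduct.quotTensorEquivQuotSMul L (maximalIdeal o)).extendScalarsOfSurjective
      (S := o ⧸ maximalIdeal o) Ideal.Quotient.mk_surjective).finrank_eq, finrank_baseChange,
      finrank_eq_card_basis v, Fintype.card_fin]
  have hsum : dimModRadical q + finrank (o ⧸ maximalIdeal o) R = n := by
    rw [← hn]
    exact Submodule.finrank_quotient_add_finrank R
  let b := ((bR.sumQuot bQ).reindex (Equiv.sumComm _ _)).reindex
    (finSumFinEquiv.trans (finCongr hsum))
  choose f hf using fun j =>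
    Submodule.Quotient.mk_surjective (maximalIdeal o • ⊤ : Submodule o L) (b j)
  have hspan : ⊤ ≤ Submodule.span o (Set.range f) := by
    refine le_of_eq (Eq.symm (IsLocalRing.map_mkQ_eq_top.1 (eq_top_iff.2 ?_)))
    rintro z -
    rw [← b.sum_repr z]
    refine Submodule.sum_mem _ fun i _ => ?_
    obtain ⟨r, hr⟩ := Ideal.Quotient.mk_surjective (b.repr z i)
    rw [← hr, ← hf i]
    exact ⟨r • f i, Submodule.smul_mem _ _ (Submodule.subset_span ⟨i, rfl⟩), rfl⟩
  refine ⟨by omega, basisOfTopLeSpanOfCardEqFinrank f hspan (by simp [finrank_eq_card_basis v]),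
    fun j hj => ?_⟩
  rw [coe_basisOfTopLeSpanOfCardEqFinrank]
  refine (Submodule.Quotient.mk_eq_zero _).2 ?_
  change Submodule.Quotient.mk (f j) ∈ _
  rw [hf j]
  obtain ⟨k, rfl⟩ := (finSumFinEquiv.trans (finCongr hsum)).surjective j
  rcases k with k | k
  · exfalso
    simp at hj
    omega
  · simp [b]

end Reduction

/-! ### Zeros of the Gross-Keating invariant, and bases of lattices -/

section Polar

variable {o : Type*} [CommRing o] {F : Type*} [Field F] [Algebra o F]
  {V : Type*} [AddCommGroup V] [Module F V] [Module o V]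

theorem polar_sum_smul_left (Q : QuadraticForm F V) {ι : Type*} (s : Finset ι) (c : ι → F)
    (v : ι → V) (x : V) : QuadraticMap.polar Q (∑ i ∈ s, c i • v i) x =
      ∑ i ∈ s, c i * QuadraticMap.polar Q (v i) x := by
  have h : ∀ x y, QuadraticMap.polar Q x y = QuadraticMap.polarBilin Q x y := fun _ _ => rfl
  simp only [h, map_sum, LinearMap.sum_apply, map_smul, LinearMap.smul_apply, smul_eq_mul]

theorem polar_smul_left_of_tower [IsScalarTower o F V] (Q : QuadraticForm F V) (r : o) (x y : V) :
    QuadraticMap.polar Q (r • x) y = algebraMap o F r * QuadraticMap.polar Q x y := by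
  rw [← algebraMap_smul F r x, QuadraticMap.polar_smul_left, smul_eq_mul]

theorem polar_eq_zero_of_mem_span (Q : QuadraticForm F V) {s : Set V} {x y : V}
    (hx : ∀ z ∈ s, QuadraticMap.polar Q x z = 0) (hy : y ∈ Submodule.span F s) :
    QuadraticMap.polar Q x y = 0 :=
  (Submodule.span_le (p := (QuadraticMap.polarBilin Q x).ker)).2 hx hy

end Polar

section Zeros

variable {o : Type*} [CommRing o] [IsDomain o] [IsDiscreteValuationRing o]
  {F : Type*} [Field F] [Algebra o F] [IsFractionRing o F]
  {V : Type*} [AddCommGroup V] [Module F V] [Module o V] [IsScalarTower o F V]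

theorem toModRadical_integralForm_eq_zero_iff {Q : QuadraticForm F V} {Λ : Submodule o V}
    (hΛ : IsIntegralOn o Q Λ) (x : Λ) : toModRadical (integralForm o hΛ) x = 0 ↔
      HalfOrdGE o 1 (Q x) ∧ ∀ y ∈ Λ, HalfOrdGE o 1 (QuadraticMap.polar Q x y) := by
  have hval : ∀ x, algebraMap o F (integralForm o hΛ x) = Q x := algebraMap_integralFun o hΛ
  rw [toModRadical_eq_zero_iff, ← HalfOrdGE.one_iff (F := F), hval, Subtype.forall]
  refine and_congr Iff.rfl (forall_congr' fun y => forall_congr' fun hy => ?_)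
  rw [← HalfOrdGE.one_iff (F := F), QuadraticMap.polar, map_sub, map_sub, hval, hval, hval]
  rfl

/-- The number of zeros of the Gross-Keating invariant is the dimension modulo the radical. A basis
adapted to the radical admits the sequence `(0, …, 0, 1, …, 1)`, and conversely the basis vectors
with positive entry lie in the radical modulo `π`. -/
theorem ncard_zeros_eq_dimModRadical (h2 : (2 : F) ≠ 0) {Q : QuadraticForm F V}
    {Λ : Submodule o V} (hΛ : IsIntegralOn o Q Λ) {n : ℕ} {g : Fin n → ℕ}
    (hg : LatticeHasGK o Q Λ g) :
    {i | g i = 0}.ncard = dimModRadical (integralForm o hΛ) := by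
  obtain ⟨v, hv⟩ := hg
  obtain ⟨⟨w, hw⟩, hmax⟩ := (hasGK_gram_iff o Q v g).1 hv
  obtain ⟨hmono, hdiag, hpol⟩ := (mem_admissibleSeqs_gram_iff o h2 Q _ g).1 hw
  apply le_antisymm
  · obtain ⟨hr, w', hw'⟩ := exists_basis_adapted_radical (integralForm o hΛ) v
    set r := dimModRadical (integralForm o hΛ)
    let b : Fin n → ℕ := fun j => if r ≤ j then 1 else 0
    have hrad := fun j hj => (toModRadical_integralForm_eq_zero_iff hΛ (w' j)).1 (hw' j hj)
    -- orders are integers, so `2 ord x ≥ 1` gives `2 ord x ≥ 2`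
    have two_of_one : ∀ {x : F}, HalfOrdGE o 1 x → HalfOrdGE o 2 x := fun h =>
      (HalfOrdGE.iff_of_ceil (k := 1) (by omega) (by omega)).2
        ((HalfOrdGE.iff_of_ceil (k := 1) (by omega) (by omega)).1 h)
    have hb : b ∈ admissibleSeqs o (gram Q fun i => (w' i : V)) := by
      rw [mem_admissibleSeqs_gram_iff o h2]
      refine ⟨fun i j hij => ?_, fun i => ?_, fun i j => ?_⟩
      · have : (i : ℕ) ≤ j := hij
        simp only [b]
        split_ifs <;> omega
      · by_cases hi : r ≤ i
        · exact (two_of_one (hrad i hi).1).mono (by simp [b, hi])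
        · exact (HalfOrdGE.zero_iff.2 (hΛ _ (w' i).2)).mono (by simp [b, hi])
      · by_cases hi : r ≤ i
        · exact (two_of_one ((hrad i hi).2 _ (w' j).2)).mono
            (by simp only [b]; split_ifs; all_goals norm_num)
        by_cases hj : r ≤ j
        · rw [QuadraticMap.polar_comm]
          exact (two_of_one ((hrad j hj).2 _ (w' i).2)).mono
            (by simp only [b]; split_ifs; all_goals norm_num)
        · exact (hΛ.polar (w' i).2 (w' j).2).mono (by simp [b, hi, hj])
    have hle := hmax w' b hb
    have hsub : {i | g i = 0} ⊆ {i : Fin n | (i : ℕ) < r} := by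
      intro i hi
      by_contra hri
      have hri : r ≤ i := not_lt.1 hri
      have hz : ∀ j ≤ i, g j = 0 := fun j hj => Nat.le_zero.1 (hi ▸ hmono hj)
      refine absurd hle (not_le.2 ⟨⟨r, by omega⟩, fun j hj => ?_, ?_⟩)
      · have hj : (j : ℕ) < r := hj
        change g j = b j
        rw [hz j (Fin.le_def.2 (by omega))]
        simp [b, hj]
      · change g _ < b _
        rw [hz _ (Fin.le_def.2 hri)]
        simp [b]
    refine (Set.ncard_le_ncard hsub).trans ?_
    rw [Set.ncard_eq_toFinset_card', ← Finset.card_range r]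
    exact Finset.card_le_card_of_injOn (fun i => (i : ℕ)) (by simp [Set.MapsTo])
      Fin.val_injective.injOn
  · rw [Set.ncard_eq_toFinset_card']
    refine dimModRadical_le_card _ w _ fun j hj => ?_
    have hj : 1 ≤ g j := by simpa [Nat.one_le_iff_ne_zero] using hj
    refine (toModRadical_integralForm_eq_zero_iff hΛ _).2 ⟨(hdiag j).mono (by omega),
      fun y hy => ?_⟩
    have hy' : _ = y := congrArg Subtype.val (w.sum_repr ⟨y, hy⟩)
    rw [AddSubmonoidClass.coe_finsetSum] at hy'
    rw [QuadraticMap.polar_comm, ← hy']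
    simp only [Submodule.coe_smul, ← algebraMap_smul F (w.repr _ _), polar_sum_smul_left]
    refine HalfOrdGE.sum fun i _ => ?_
    exact ((HalfOrdGE.zero_iff.2 ⟨_, rfl⟩).mul (hpol i j)).mono (by omega)

/-- A lattice in the span of `r` linearly independent vectors which contains these vectors is free
of rank `r`. -/
theorem exists_basis_of_lattice {r : ℕ} {f : Fin r → V} (hf : LinearIndependent F f)
    {Λ : Submodule o V} (hfg : Λ.FG) (hle : ∀ i, f i ∈ Λ)
    (hspan : ∀ x ∈ Λ, x ∈ Submodule.span F (Set.range f)) :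
    ∃ w : Basis (Fin r) o Λ, LinearIndependent F (fun i => (w i : V)) ∧
      Submodule.span F (Set.range fun i => (w i : V)) = Submodule.span F (Set.range f) := by
  have : Module.Finite o Λ := Module.Finite.iff_fg.2 hfg
  have : Module.IsTorsionFree o F := by
    exact Module.isTorsionFree_iff_algebraMap_injective.2 (IsFractionRing.injective o F)
  have : Module.IsTorsionFree o V := Module.IsTorsionFree.trans F
  have : Module.Free o Λ := inferInstance
  let w := Module.finBasis o Λ
  have hli : LinearIndependent F (fun i => (w i : V)) := by
    rw [← LinearIndependent.iff_fractionRing o F]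
    exact w.linearIndependent.map' Λ.subtype (Submodule.ker_subtype _)
  have hsp : Submodule.span F (Set.range fun i => (w i : V)) =
      Submodule.span F (Set.range f) := by
    apply le_antisymm
    · rw [Submodule.span_le]
      rintro _ ⟨i, rfl⟩
      exact hspan _ (w i).2
    · rw [Submodule.span_le]
      rintro _ ⟨i, rfl⟩
      have hy' : _ = f i := congrArg Subtype.val (w.sum_repr ⟨f i, hle i⟩)
      rw [AddSubmonoidClass.coe_finsetSum] at hy'
      rw [← hy']
      refine Submodule.sum_mem _ fun j _ => ?_
      rw [Submodule.coe_smul, ← algebraMap_smul F]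
      exact Submodule.smul_mem _ _ (Submodule.subset_span ⟨j, rfl⟩)
  have hr : finrank o Λ = r := by
    have h1 := finrank_span_eq_card hli
    rw [hsp, finrank_span_eq_card hf] at h1
    simpa using h1.symm
  refine ⟨w.reindex (finCongr hr), ?_, ?_⟩
  · simp only [Basis.reindex_apply]
    exact hli.comp _ (finCongr hr).symm.injective
  · rw [← hsp]
    congr 1
    simp only [Basis.reindex_apply]
    exact (finCongr hr).symm.surjective.range_comp fun i => (w i : V)

theorem det_gram_ne_zero (h2 : (2 : F) ≠ 0) (Q : QuadraticForm F V) {n : ℕ} {v : Fin n → V}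
    (hv : LinearIndependent F v)
    (hnd : ∀ x ∈ Submodule.span F (Set.range v), (∀ i, QuadraticMap.polar Q x (v i) = 0) → x = 0) :
    (gram Q v).det ≠ 0 := by
  intro h
  obtain ⟨c, hc, hc0⟩ := Matrix.exists_mulVec_eq_zero_iff.2 h
  apply hc
  have hx : ∑ i, c i • v i = 0 := by
    refine hnd _ (Submodule.sum_mem _ fun i _ =>
      Submodule.smul_mem _ _ (Submodule.subset_span ⟨i, rfl⟩)) fun i => ?_
    have := congrFun hc0 i
    rw [Matrix.mulVec, dotProduct] at this
    rw [polar_sum_smul_left]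
    calc _ = 2 * ∑ j, gram Q v i j * c j := by
          rw [Finset.mul_sum]
          refine Finset.sum_congr rfl fun j _ => ?_
          rw [← mul_assoc, two_mul_gram_apply h2, QuadraticMap.polar_comm, mul_comm]
      _ = 0 := by rw [this]; simp
  exact funext (Fintype.linearIndependent_iff.1 hv c hx)

end Zeros

/-! ### Overlattices orthogonal to the last block -/

section Overlattice

variable {o : Type*} [CommRing o] [IsDomain o] [IsDiscreteValuationRing o]
  {F : Type*} [Field F] [Algebra o F] [IsFractionRing o F]
  {V : Type*} [AddCommGroup V] [Module F V] [Module o V]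

theorem IsLatticeWithLastBlock.last_pos {Q : QuadraticForm F V} {m d : ℕ}
    {e : Basis (Fin (m + d)) F V} {a : Fin (m + d) → ℕ} (h : IsLatticeWithLastBlock o Q e a)
    (j : Fin d) : 0 < a (Fin.natAdd m j) := by
  obtain ⟨i, hi⟩ := Function.ne_iff.1 h.ne_zero
  have hi : a i ≠ 0 := hi
  induction i using Fin.addCases with
  | left i => have := h.lt_last i j; omega
  | right i => have := h.last_eq i j; omega

variable [IsScalarTower o F V]

/-- The assertion on overlattices follows once `M'` is orthogonal to `N` modulo `π`: then `N` lies
in the radical of `L' / πL'`. -/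
theorem overlatticeProperty_of_polar (h2 : (2 : F) ≠ 0) {Q : QuadraticForm F V} {m d : ℕ}
    {e : Basis (Fin (m + d)) F V} {a : Fin (m + d) → ℕ} (h : IsLatticeWithLastBlock o Q e a)
    (ha : a ∈ admissibleSeqs o (gram Q e))
    (hK : ∀ M' : Submodule o V, IsOverlattice o e M' → IsIntegralOn o Q M' →
      ∀ x ∈ M', ∀ j : Fin d, HalfOrdGE o 1 (QuadraticMap.polar Q x (e (Fin.natAdd m j))))
    (hnd : ∀ x ∈ Submodule.span F (Set.range fun i : Fin m => e (Fin.castAdd d i)),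
      (∀ i, QuadraticMap.polar Q x (e (Fin.castAdd d i)) = 0) → x = 0) :
    OverlatticeProperty o Q e := by
  intro M' hM'
  obtain ⟨-, hdiag, hpol⟩ := (mem_admissibleSeqs_gram_iff o h2 Q _ a).1 ha
  set N := Submodule.span o (Set.range fun j : Fin d => e (Fin.natAdd m j)) with hN
  have hcomm := QuadraticMap.polar_comm Q
  have hMN : IsIntegralOn o Q M' → ∀ z ∈ N, ∀ y ∈ extendByN o e M',
      HalfOrdGE o 1 (QuadraticMap.polar Q z y) := by
    intro hM z hz y hy
    refine Submodule.span_induction ?_ ?_ ?_ ?_ hz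
    · rintro _ ⟨j, rfl⟩
      obtain ⟨x, hx, u, hu, rfl⟩ := Submodule.mem_sup.1 hy
      rw [QuadraticMap.polar_add_right, hcomm _ x]
      refine (hK M' hM' hM x hx j).add ?_
      refine Submodule.span_induction ?_ ?_ ?_ ?_ hu
      · rintro _ ⟨i, rfl⟩
        have := h.last_pos j
        exact (hpol _ _).mono (by omega)
      · rw [QuadraticMap.polar_zero_right]
        exact HalfOrdGE.zero _
      · intro u u' _ _ hu hu'
        rw [QuadraticMap.polar_add_right]
        exact hu.add hu'
      · intro r u _ hu
        rw [hcomm, polar_smul_left_of_tower, hcomm]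
        exact ((HalfOrdGE.zero_iff.2 ⟨r, rfl⟩).mul hu).mono (by omega)
    · rw [QuadraticMap.polar_zero_left]
      exact HalfOrdGE.zero _
    · intro u u' _ _ hu hu'
      rw [QuadraticMap.polar_add_left]
      exact hu.add hu'
    · intro r u _ hu
      rw [polar_smul_left_of_tower]
      exact ((HalfOrdGE.zero_iff.2 ⟨r, rfl⟩).mul hu).mono (by omega)
  have hNL : N ≤ extendByN o e M' := le_sup_right
  have hML : M' ≤ extendByN o e M' := le_sup_left
  have hQN : IsIntegralOn o Q M' → ∀ z ∈ N, HalfOrdGE o 1 (Q z) := by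
    intro hM z hz
    refine Submodule.span_induction ?_ ?_ ?_ ?_ hz
    · rintro _ ⟨j, rfl⟩
      have := h.last_pos j
      exact (hdiag _).mono (by omega)
    · rw [QuadraticMap.map_zero]
      exact HalfOrdGE.zero _
    · intro u u' hu hu' h1 h1'
      rw [QuadraticMap.map_add Q]
      exact (h1.add h1').add (hMN hM u hu u' (hNL hu'))
    · intro r u _ hu
      rw [← algebraMap_smul F r u, QuadraticMap.map_smul, smul_eq_mul, ← map_mul]
      exact ((HalfOrdGE.zero_iff.2 ⟨_, rfl⟩).mul hu).mono (by omega)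
  refine ⟨⟨fun hM y hy => ?_, fun hL x hx => hL x (hML hx)⟩, fun hM hL => ?_⟩
  · obtain ⟨x, hx, z, hz, rfl⟩ := Submodule.mem_sup.1 hy
    rw [← HalfOrdGE.zero_iff, QuadraticMap.map_add Q, hcomm]
    exact ((HalfOrdGE.zero_iff.2 (hM x hx)).add ((hQN hM z hz).mono (by omega))).add
      ((hMN hM z hz x (hML hx)).mono (by omega))
  have hdim : dimModRadical (integralForm o hL) = dimModRadical (integralForm o hM) := by
    refine dimModRadical_eq_of_linearMap _ _ (Submodule.inclusion hML) (fun x => ?_) ?_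
    · apply IsFractionRing.injective o F
      exact (algebraMap_integralFun o hL _).trans (algebraMap_integralFun o hM _).symm
    · rintro ⟨y, hy⟩
      obtain ⟨x, hx, z, hz, rfl⟩ := Submodule.mem_sup.1 hy
      refine ⟨⟨x, hx⟩, (toModRadical_integralForm_eq_zero_iff hL _).2 ?_⟩
      have hxz : x + z - x = z := by abel
      simp only [AddSubgroupClass.coe_sub, Submodule.coe_inclusion, hxz]
      exact ⟨hQN hM z hz, hMN hM z hz⟩
  refine ⟨hdim, ?_⟩
  obtain ⟨w, hw, hwspan⟩ := exists_basis_of_lattice (o := o)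
    (e.linearIndependent.comp _ (Fin.castAdd_injective m d)) hM'.fg
    (fun i => hM'.le (Submodule.subset_span ⟨i, rfl⟩)) hM'.le_span
  obtain ⟨h0, hh0⟩ := exists_latticeHasGK o h2 Q hM w
    (det_gram_ne_zero h2 Q hw fun x hx hx0 => hnd x (hwspan ▸ hx) fun i =>
      polar_eq_zero_of_mem_span Q (Set.forall_mem_range.2 hx0)
        (hwspan ▸ Submodule.subset_span ⟨i, rfl⟩))
  have hLfg : (extendByN o e M').FG := hM'.fg.sup (Submodule.fg_span (Set.finite_range _))
  obtain ⟨w', hw', hwspan'⟩ := exists_basis_of_lattice (o := o) e.linearIndependent hLfg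
    (fun i => by
      induction i using Fin.addCases with
      | left i => exact hML (hM'.le (Submodule.subset_span ⟨i, rfl⟩))
      | right i => exact hNL (Submodule.subset_span ⟨i, rfl⟩))
    (fun x _ => e.span_eq ▸ Submodule.mem_top)
  obtain ⟨g, hg⟩ := exists_latticeHasGK o h2 Q hL w'
    (det_gram_ne_zero h2 Q hw' fun x hx hx0 => h.nondegenerate.1 x fun y =>
      polar_eq_zero_of_mem_span Q (Set.forall_mem_range.2 hx0)
        (hwspan' ▸ e.span_eq ▸ Submodule.mem_top))
  refine ⟨g, h0, hg, hh0, ?_⟩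
  rw [ncard_zeros_eq_dimModRadical h2 hL hg, ncard_zeros_eq_dimModRadical h2 hM hh0, hdim]

end Overlattice

/-! ### Optimal bases when two is a unit -/

section Optimal

variable {o : Type*} [CommRing o] [IsDomain o] [IsDiscreteValuationRing o]
  {F : Type*} [Field F] [Algebra o F] [IsFractionRing o F]
  {V : Type*} [AddCommGroup V] [Module F V] [Module o V] [IsScalarTower o F V]

/-- The exchange argument for optimal bases when `2` is a unit; call `a_j` the weight of `e_j`.
Let `w = ∑ y_j e_j`, with `t = a_k` the largest weight occurring and `y_k = 1`. If `w` were
orthogonal to all `e_i` with `a_i ≤ t` to a higher order than `a ∈ S(B)` forces, then one basis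
vector of weight `t` could be exchanged against `w`. The new basis admits the sequence that agrees
with `a` before the last entry `t` and has the constant value `t + 1` from that entry on: it is
lexicographically larger than `a`. -/
theorem exists_not_halfOrdGE_polar (h2 : IsUnit (2 : o)) (Q : QuadraticForm F V) {n : ℕ}
    (e : Basis (Fin n) F V) {a : Fin n → ℕ} (ha : IsOptimal o (gram Q e) a) {k : Fin n}
    {y : Fin n → F} (hk : y k = 1) (hy0 : ∀ j, a k < a j → y j = 0)
    (hy : ∀ j, HalfOrdGE o (a k - a j) (y j)) :
    ∃ i, a i ≤ a k ∧
      ¬ HalfOrdGE o (a k + a i + 1) (QuadraticMap.polar Q (∑ j, y j • e j) (e i)) := by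
  by_contra! hcon
  have h2F : (2 : F) ≠ 0 := two_ne_zero_of_isUnit F h2
  obtain ⟨hGK, haS⟩ := ha
  obtain ⟨hmono, hdiag, hpol⟩ := (mem_admissibleSeqs_gram_iff o h2F Q _ a).1 haS
  set w := ∑ j, y j • e j with hw
  have hwe : ∀ i, HalfOrdGE o (a k + a i) (QuadraticMap.polar Q w (e i)) := by
    intro i
    rw [hw, polar_sum_smul_left]
    exact HalfOrdGE.sum fun j _ => ((hy j).mul (hpol j i)).mono (by omega)
  have hww : HalfOrdGE o (2 * a k + 1) (QuadraticMap.polar Q w w) := by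
    conv in QuadraticMap.polar Q w w => rw [hw, polar_sum_smul_left]
    refine HalfOrdGE.sum fun j _ => ?_
    rcases lt_or_ge (a k) (a j) with hj | hj
    · rw [hy0 j hj, zero_mul]
      exact HalfOrdGE.zero _
    · rw [QuadraticMap.polar_comm]
      exact ((hy j).mul (hcon j hj)).mono (by omega)
  have hQw : HalfOrdGE o (2 * a k + 1) (Q w) := by
    obtain ⟨u, hu⟩ := h2
    have e1 : Q w = algebraMap o F ↑u⁻¹ * QuadraticMap.polar Q w w := by
      have e2 : algebraMap o F ↑u⁻¹ * 2 = 1 := by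
        rw [← map_ofNat (algebraMap o F) 2, ← hu, ← map_mul, Units.inv_mul, map_one]
      rw [QuadraticMap.polar_self, nsmul_eq_mul, Nat.cast_ofNat, ← mul_assoc, e2, one_mul]
    rw [e1]
    exact ((HalfOrdGE.zero_iff.2 ⟨_, rfl⟩).mul hww).mono (by omega)
  -- the last position `l` carrying the value `a k`
  obtain ⟨l, hl, hlmax⟩ := Finset.exists_max_image (Finset.univ.filter fun j => a j = a k) id
    ⟨k, by simp⟩
  simp only [Finset.mem_filter, Finset.mem_univ, true_and, id] at hl hlmax
  have hgt : ∀ j, l < j → a k + 1 ≤ a j := by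
    intro j hj
    have h1 := hmono hj.le
    by_contra h3
    exact absurd (hlmax j (by omega)) (not_le.2 hj)
  have hlt : ∀ j, j < l → a j ≤ a k := fun j hj => hl ▸ hmono hj.le
  let s := Equiv.swap k l
  have hs : ∀ j, a (s j) = a j := by
    intro j
    rcases eq_or_ne j k with rfl | hjk
    · rw [Equiv.swap_apply_left, hl]
    rcases eq_or_ne j l with rfl | hjl
    · rw [Equiv.swap_apply_right, hl]
    · rw [Equiv.swap_apply_of_ne_of_ne hjk hjl]
  -- exchange `e k` against `w`, which takes position `l`
  let f : Fin n → V := fun j => if j = l then w else e (s j)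
  let Λ := Submodule.span o (Set.range e)
  let v : Basis (Fin n) o Λ := e.restrictScalars o
  have hv : ∀ i, (v i : V) = e i := fun i => e.restrictScalars_apply o i
  have hyo : ∀ j, ∃ z, algebraMap o F z = y j := by
    intro j
    refine HalfOrdGE.zero_iff.1 ?_
    rcases lt_or_ge (a k) (a j) with hj | hj
    · rw [hy0 j hj]
      exact HalfOrdGE.zero _
    · exact (hy j).mono (by omega)
  choose z hz using hyo
  have hwz : w = ∑ j, z j • e j := by
    rw [hw]
    refine Finset.sum_congr rfl fun j _ => ?_
    rw [← hz, algebraMap_smul]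
  have hzk : z k = 1 := by
    apply IsFractionRing.injective o F
    rw [hz, hk, map_one]
  have heΛ : ∀ j, e j ∈ Λ := fun j => Submodule.subset_span ⟨j, rfl⟩
  have hfΛ : ∀ j, f j ∈ Λ := by
    intro j
    simp only [f]
    split_ifs
    · rw [hwz]
      exact Submodule.sum_mem _ fun i _ => Submodule.smul_mem _ _ (heΛ i)
    · exact heΛ _
  let f' : Fin n → Λ := fun j => ⟨f j, hfΛ j⟩
  have hspan : ⊤ ≤ Submodule.span o (Set.range f') := by
    have hne : ∀ j, j ≠ k → v j ∈ Submodule.span o (Set.range f') := by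
      intro j hj
      have hsj : s j ≠ l := fun h => hj (s.injective (h.trans (Equiv.swap_apply_left k l).symm))
      have : v j = f' (s j) := by
        apply Subtype.ext
        simp [f', f, hsj, hv, s]
      rw [this]
      exact Submodule.subset_span ⟨_, rfl⟩
    have hall : ∀ j, v j ∈ Submodule.span o (Set.range f') := by
      intro j
      rcases eq_or_ne j k with rfl | hj
      · have e1 : v j = f' l - ∑ i ∈ Finset.univ.erase j, z i • v i := by
          rw [eq_sub_iff_add_eq]
          apply Subtype.ext
          have : (f' l : V) = w := by simp [f', f]
          rw [this, hwz, ← Finset.add_sum_erase _ _ (Finset.mem_univ j), hzk, one_smul,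
            Submodule.coe_add, AddSubmonoidClass.coe_finsetSum]
          simp only [Submodule.coe_smul, hv]
        rw [e1]
        exact sub_mem (Submodule.subset_span ⟨_, rfl⟩) (Submodule.sum_mem _ fun i hi =>
          Submodule.smul_mem _ _ (hne i (Finset.ne_of_mem_erase hi)))
      · exact hne j hj
    rw [← v.span_eq, Submodule.span_le]
    rintro _ ⟨j, rfl⟩
    exact hall j
  let b' := basisOfTopLeSpanOfCardEqFinrank f' hspan (by rw [finrank_eq_card_basis v])
  have hb' : ∀ j, (b' j : V) = f j := fun j => by
    simp only [b', coe_basisOfTopLeSpanOfCardEqFinrank, f']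
  -- the larger sequence
  let b : Fin n → ℕ := fun j => if j < l then a j else a k + 1
  have hbS : b ∈ admissibleSeqs o (gram Q fun i => (b' i : V)) := by
    have hba : ∀ j, j ≠ l → b j ≤ a j := by
      intro j hj
      simp only [b]
      split_ifs with h
      · exact le_rfl
      · exact hgt j (lt_of_le_of_ne (not_lt.1 h) hj.symm)
    have hbl : b l = a k + 1 := by simp [b]
    have hwf : ∀ j, j ≠ l → HalfOrdGE o (a k + 1 + b j) (QuadraticMap.polar Q w (e (s j))) := by
      intro j hj
      rcases lt_or_gt_of_ne hj with h | h
      · have := hcon (s j) (by rw [hs]; exact hlt j h)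
        rw [hs] at this
        exact this.mono (by simp only [b, if_pos h]; omega)
      · -- here `a j ≥ a k + 1`, and the odd bound `2 a k + 1` on `2 ord` improves to `2 a k + 2`
        have h3 := hgt j h
        have h4 := hwe (s j)
        rw [hs] at h4
        have h5 : b j = a k + 1 := by simp [b, h.le]
        rw [h5, HalfOrdGE.iff_of_ceil (k := a k + 1) (by push_cast; omega) (by push_cast; omega)]
        exact (HalfOrdGE.iff_of_ceil (c := 2 * a k + 1) (by omega) (by omega)).1
          (h4.mono (by omega))
    rw [mem_admissibleSeqs_gram_iff o h2F]
    simp only [hb', f]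
    refine ⟨fun i j hij => ?_, fun i => ?_, fun i j => ?_⟩
    · simp only [b]
      split_ifs with h1 h3 h3
      · exact hmono hij
      · exact (hlt i h1).trans (Nat.le_succ _)
      · exact absurd (hij.trans_lt h3) h1
      · exact le_rfl
    · split_ifs with hi
      · rw [hi, hbl]
        rw [HalfOrdGE.iff_of_ceil (k := a k + 1) (by push_cast; omega) (by push_cast; omega)]
        exact (HalfOrdGE.iff_of_ceil (by omega) (by omega)).1 hQw
      · have := hdiag (s i)
        rw [hs] at this
        exact this.mono (by have := hba i hi; omega)
    · split_ifs with hi hj hj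
      · rw [hi, hj, hbl]
        rw [HalfOrdGE.iff_of_ceil (k := a k + 1) (by push_cast; omega) (by push_cast; omega)]
        exact (HalfOrdGE.iff_of_ceil (by omega) (by omega)).1 hww
      · rw [hi, hbl]
        exact (hwf j hj).mono (by push_cast; omega)
      · rw [hj, hbl, QuadraticMap.polar_comm]
        exact (hwf i hi).mono (by push_cast; omega)
      · have := hpol (s i) (s j)
        rw [hs, hs] at this
        exact this.mono (by have := hba i hi; have := hba j hj; omega)
  have hGK' : HasGK o (gram Q fun i => (v i : V)) a := by
    simpa only [hv] using hGK
  refine absurd (((hasGK_gram_iff o Q v a).1 hGK').2 b' b hbS) (not_le.2 ⟨l, fun j hj => ?_, ?_⟩)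
  · change a j = b j
    simp [b, show j < l from hj]
  · change a l < b l
    simp [b, hl]

/-- For an optimal basis and `2` a unit, let `μ = min_j (2 ord x_j + a_j)` be the weighted order of
`x ≠ 0`. Then the bound `2 ord (x, e_i) ≥ μ + a_i`, valid for all `i`, is an equality for some `i`,
and `a_i ≤ a_k` for some `k` with `x_k ≠ 0`. In particular
the form is nondegenerate on every span of initial basis vectors of weight `≤ c`. -/
theorem exists_dominant_index (h2 : IsUnit (2 : o)) (Q : QuadraticForm F V) {n : ℕ}
    (e : Basis (Fin n) F V) {a : Fin n → ℕ} (ha : IsOptimal o (gram Q e) a) {x : Fin n → F}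
    (hx : x ≠ 0) : ∃ (k : Fin n) (μ : ℤ), x k ≠ 0 ∧ (∀ j, HalfOrdGE o (μ - a j) (x j)) ∧
      ∃ i, a i ≤ a k ∧
        ¬ HalfOrdGE o (μ + a i + 1) (QuadraticMap.polar Q (∑ j, x j • e j) (e i)) := by
  classical
  have h2F : (2 : F) ≠ 0 := two_ne_zero_of_isUnit F h2
  obtain ⟨hmono, hdiag, hpol⟩ := (mem_admissibleSeqs_gram_iff o h2F Q _ a).1 ha.2
  have hord : ∀ j, ∃ l : ℤ, x j ≠ 0 → ord o (x j) = l := by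
    intro j
    by_cases hj : x j = 0
    · exact ⟨0, fun h => absurd hj h⟩
    · obtain ⟨l, hl⟩ := exists_ord_eq (o := o) hj
      exact ⟨l, fun _ => hl⟩
  choose l hl using hord
  -- `k` minimizes `2 ord x_j + a_j` and, among the minimizers, has the largest weight
  obtain ⟨j0, hj0⟩ := Function.ne_iff.1 hx
  obtain ⟨k, hk, hkmax⟩ := Finset.exists_max_image (Finset.univ.filter fun j => x j ≠ 0)
    (fun j => toLex (-(2 * l j + a j), a j)) ⟨j0, by simpa using hj0⟩
  simp only [Finset.mem_filter, Finset.mem_univ, true_and, Prod.Lex.toLex_le_toLex] at hk hkmax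
  have hinv : HalfOrdGE o (-(2 * l k)) (x k)⁻¹ := by
    rw [HalfOrdGE.iff_of_ord (ord_inv_eq hk (hl k hk))]
    omega
  have hxj : ∀ j, HalfOrdGE o (2 * l k + a k - a j) (x j) := by
    intro j
    by_cases hj : x j = 0
    · rw [hj]
      exact HalfOrdGE.zero _
    · rw [HalfOrdGE.iff_of_ord (hl j hj)]
      have := hkmax j hj
      omega
  have hxj' : ∀ j, a k < a j → HalfOrdGE o (2 * l k + a k - a j + 1) (x j) := by
    intro j hkj
    by_cases hj : x j = 0
    · rw [hj]
      exact HalfOrdGE.zero _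
    · rw [HalfOrdGE.iff_of_ord (hl j hj)]
      have := hkmax j hj
      omega
  refine ⟨k, 2 * l k + a k, hk, hxj, ?_⟩
  -- normalize the `k`-th coordinate and drop the coordinates of larger weight
  obtain ⟨i, hi, hpi⟩ := exists_not_halfOrdGE_polar h2 Q e ha (k := k)
    (y := fun j => if a j ≤ a k then (x k)⁻¹ * x j else 0) (by simp [hk])
    (fun j hj => if_neg (not_le.2 hj)) (fun j => by
      split_ifs
      · exact (hinv.mul (hxj j)).mono (by omega)
      · exact HalfOrdGE.zero _)
  refine ⟨i, hi, fun hcon => hpi ?_⟩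
  rw [polar_sum_smul_left] at hcon ⊢
  have hsplit : ∑ j, (if a j ≤ a k then (x k)⁻¹ * x j else 0) * QuadraticMap.polar Q (e j) (e i) =
      (x k)⁻¹ * ∑ j, x j * QuadraticMap.polar Q (e j) (e i) +
        ∑ j, -(if a j ≤ a k then 0 else (x k)⁻¹ * (x j * QuadraticMap.polar Q (e j) (e i))) := by
    rw [Finset.mul_sum, ← Finset.sum_add_distrib]
    refine Finset.sum_congr rfl fun j _ => ?_
    split_ifs <;> ring
  rw [hsplit]
  refine ((hinv.mul hcon).mono (by omega)).add (HalfOrdGE.sum fun j _ => HalfOrdGE.neg ?_)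
  split_ifs with hj
  · exact HalfOrdGE.zero _
  · exact (hinv.mul ((hxj' j (not_le.1 hj)).mul (hpol j i))).mono (by omega)

end Optimal

/-! ### The two cases -/

section OddCase

variable {o : Type*} [CommRing o] [IsDomain o] [IsDiscreteValuationRing o]
  {F : Type*} [Field F] [Algebra o F] [IsFractionRing o F]
  {V : Type*} [AddCommGroup V] [Module F V] [Module o V] [IsScalarTower o F V]

/-- If `2` is a unit, `x ∈ M'` pairs integrally with `M ⊆ M'`. As the weighted order `μ` of `x` is
detected by some `e_i` in `M`, this gives `μ ≥ -a_i`, whereas `(x, e_j)` for `e_j ∈ N` has doubled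
order at least `μ + a_j > 0`. -/
theorem overlatticeProperty_of_isOptimal (h2 : IsUnit (2 : o)) {Q : QuadraticForm F V} {m d : ℕ}
    {e : Basis (Fin (m + d)) F V} {a : Fin (m + d) → ℕ} (h : IsLatticeWithLastBlock o Q e a)
    (ha : IsOptimal o (gram Q e) a) : OverlatticeProperty o Q e := by
  have h2F : (2 : F) ≠ 0 := two_ne_zero_of_isUnit F h2
  obtain ⟨-, -, hpol⟩ := (mem_admissibleSeqs_gram_iff o h2F Q _ a).1 ha.2
  -- the exchange argument inside `M`: all indices it produces lie below the last block
  have key : ∀ x ∈ Submodule.span F (Set.range fun i : Fin m => e (Fin.castAdd d i)), x ≠ 0 →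
      ∃ (c : Fin m → F) (k : Fin m) (μ : ℤ), ∑ j, c j • e (Fin.castAdd d j) = x ∧
        (∀ j, HalfOrdGE o (μ - a (Fin.castAdd d j)) (c j)) ∧
        ∃ i : Fin m, a (Fin.castAdd d i) ≤ a (Fin.castAdd d k) ∧
          ¬ HalfOrdGE o (μ + a (Fin.castAdd d i) + 1)
            (QuadraticMap.polar Q x (e (Fin.castAdd d i))) := by
    intro x hx hx0
    obtain ⟨c, rfl⟩ := (Submodule.mem_span_range_iff_exists_fun F).1 hx
    have hsum : ∑ j, (Fin.append c (0 : Fin d → F)) j • e j =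
        ∑ j, c j • e (Fin.castAdd d j) := by
      simp [Fin.sum_univ_add]
    have hc : Fin.append c (0 : Fin d → F) ≠ 0 := by
      intro hc
      apply hx0
      rw [← hsum, hc]
      simp
    obtain ⟨k, μ, hk, hμ, i, hi, hpi⟩ := exists_dominant_index h2 Q e ha hc
    rw [hsum] at hpi
    induction k using Fin.addCases with
    | right k => exact absurd (by simp) hk
    | left k =>
      induction i using Fin.addCases with
      | right i => exact absurd hi (not_le.2 (h.lt_last k i))
      | left i => exact ⟨c, k, μ, rfl, fun j => by simpa using hμ (Fin.castAdd d j), i, hi, hpi⟩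
  refine overlatticeProperty_of_polar h2F h ha.2 (fun M' hM' hM x hx j => ?_) fun x hx hx0 => ?_
  · by_cases hx0 : x = 0
    · rw [hx0, QuadraticMap.polar_zero_left]
      exact HalfOrdGE.zero _
    obtain ⟨c, k, μ, rfl, hμ, i, hi, hpi⟩ := key x (hM'.le_span x hx) hx0
    have h1 := hM.polar hx (hM'.le (Submodule.subset_span ⟨i, rfl⟩))
    have h3 : 0 < μ + a (Fin.castAdd d i) + 1 := by
      by_contra hcon
      exact hpi (h1.mono (by omega))
    have h4 := h.lt_last k j
    rw [polar_sum_smul_left]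
    exact HalfOrdGE.sum fun l _ => ((hμ l).mul (hpol _ _)).mono (by omega)
  · by_contra hne
    obtain ⟨c, k, μ, -, -, i, -, hpi⟩ := key x hx hne
    rw [hx0 i] at hpi
    exact hpi (HalfOrdGE.zero _)

end OddCase

section Anisotropic

variable {p : ℕ} [Fact p.Prime] {V : Type*} [AddCommGroup V] [Module ℚ_[p] V]

/-- A case of the Cauchy-Schwarz inequality `2 ord (x, y) ≥ ord Q(x) + ord Q(y)` for anisotropic
forms. If it fails, then after division by `(x, y)` the polynomial `Q(t x + y)` in `t` has integral
coefficients, constant term in `p ℤ_p` and linear coefficient `1`, so that Hensel's lemma provides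
an isotropic vector. -/
theorem halfOrdGE_polar_of_anisotropic {Q : QuadraticForm ℚ_[p] V} (hQ : Q.Anisotropic) {x y : V}
    (hx : HalfOrdGE ℤ_[p] 0 (Q x)) (hy : HalfOrdGE ℤ_[p] 1 (Q y)) :
    HalfOrdGE ℤ_[p] 1 (QuadraticMap.polar Q x y) := by
  by_contra hcon
  set β := QuadraticMap.polar Q x y with hβ
  have hβ0 : β ≠ 0 := fun h => hcon (h ▸ HalfOrdGE.zero _)
  obtain ⟨k, hk⟩ := exists_ord_eq (o := ℤ_[p]) hβ0
  have hinv : HalfOrdGE ℤ_[p] 0 β⁻¹ := by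
    rw [HalfOrdGE.iff_of_ord hk] at hcon
    rw [HalfOrdGE.iff_of_ord (ord_inv_eq hβ0 hk)]
    omega
  obtain ⟨A, hA⟩ := HalfOrdGE.zero_iff.1 (hinv.mul hx)
  have hC1 : HalfOrdGE ℤ_[p] 1 (β⁻¹ * Q y) := (hinv.mul hy).mono (by omega)
  obtain ⟨C, hC⟩ := HalfOrdGE.zero_iff.1 (hC1.mono zero_le_one)
  rw [← hC, HalfOrdGE.one_iff] at hC1
  have hCnorm : ‖C‖ < 1 := PadicInt.mem_nonunits.1 hC1
  let f : Polynomial ℤ_[p] :=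
    Polynomial.C A * Polynomial.X ^ 2 + Polynomial.X + Polynomial.C C
  have hf : ∀ t, f.aeval t = A * t ^ 2 + t + C := fun t => by simp [f]
  have hf' : f.derivative.aeval (0 : ℤ_[p]) = 1 := by simp [f]
  obtain ⟨s, hs, hs1, -⟩ := hensels_lemma (F := f) (a := 0)
    (by rw [hf, hf']; simpa using hCnorm)
  rw [hf', sub_zero, norm_one] at hs1
  rw [hf] at hs
  have hs' : HalfOrdGE ℤ_[p] 1 (algebraMap ℤ_[p] ℚ_[p] s) :=
    HalfOrdGE.one_iff.2 (PadicInt.mem_nonunits.2 hs1)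
  set t := algebraMap ℤ_[p] ℚ_[p] s
  -- `s` is a root in `p ℤ_p` of the divided polynomial
  have hroot : Q (t • x + y) = 0 := by
    have e1 := congrArg (algebraMap ℤ_[p] ℚ_[p]) hs
    rw [map_add, map_add, map_mul, map_pow, hA, hC, map_zero] at e1
    rw [QuadraticMap.map_add Q, QuadraticMap.map_smul, QuadraticMap.polar_smul_left, smul_eq_mul,
      smul_eq_mul, ← hβ]
    have e2 : t * t * Q x + Q y + t * β = β * (β⁻¹ * Q x * t ^ 2 + t + β⁻¹ * Q y) := by
      field_simp
      ring
    rw [e2, e1, mul_zero]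
  have hyx : y = (-t) • x := by
    rw [neg_smul, eq_neg_iff_add_eq_zero, add_comm]
    exact hQ _ hroot
  apply hcon
  rw [hβ, hyx, QuadraticMap.polar_smul_right, QuadraticMap.polar_self, smul_eq_mul, two_nsmul]
  exact (hs'.neg.mul (hx.add hx)).mono (by omega)

variable [Module ℤ_[p] V] [IsScalarTower ℤ_[p] ℚ_[p] V]

/-- For an anisotropic form only `a ∈ S(B)` is needed: it makes `Q` divisible by `p` on the basis of
`N`, and the Cauchy-Schwarz inequality does the rest. -/
theorem overlatticeProperty_of_anisotropic {Q : QuadraticForm ℚ_[p] V} {m d : ℕ}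
    {e : Basis (Fin (m + d)) ℚ_[p] V} {a : Fin (m + d) → ℕ}
    (h : IsLatticeWithLastBlock ℤ_[p] Q e a) (hQ : Q.Anisotropic)
    (ha : a ∈ admissibleSeqs ℤ_[p] (gram Q e)) : OverlatticeProperty ℤ_[p] Q e := by
  obtain ⟨-, hdiag, -⟩ := (mem_admissibleSeqs_gram_iff ℤ_[p] two_ne_zero Q _ a).1 ha
  refine overlatticeProperty_of_polar two_ne_zero h ha (fun M' hM' hM x hx j => ?_)
    fun x hx hx0 => ?_
  · have := h.last_pos j
    exact halfOrdGE_polar_of_anisotropic hQ (HalfOrdGE.zero_iff.2 (hM x hx))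
      ((hdiag _).mono (by omega))
  · have hxx := polar_eq_zero_of_mem_span Q (Set.forall_mem_range.2 hx0) hx
    rw [QuadraticMap.polar_self, two_nsmul, ← two_mul] at hxx
    exact hQ x ((mul_eq_zero.1 hxx).resolve_left two_ne_zero)

end Anisotropic

theorem isUnit_two_padicInt {p : ℕ} [Fact p.Prime] (hp : p ≠ 2) : IsUnit (2 : ℤ_[p]) := by
  rw [PadicInt.isUnit_iff]
  have := PadicInt.norm_natCast_eq_one_iff (p := p) (n := 2)
  rw [Nat.cast_ofNat] at this
  exact this.2 ((Nat.coprime_primes Fact.out Nat.prime_two).2 hp)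

end GrossKeating

theorem mainTheorem12 (p : ℕ) [Fact p.Prime] :
    -- `p` odd: an arbitrary finite extension `F` of `ℚ_p` and an optimal basis
    (p ≠ 2 →
      ∀ (F : Type*) [Field F] [Algebra ℚ_[p] F] [FiniteDimensional ℚ_[p] F]
        [Algebra ℤ_[p] F] [IsScalarTower ℤ_[p] ℚ_[p] F]
        (V : Type*) [AddCommGroup V] [Module F V] (Q : QuadraticForm F V)
        (m d : ℕ) (e : Module.Basis (Fin (m + d)) F V) (a : Fin (m + d) → ℕ),
        GrossKeating.IsLatticeWithLastBlock (integralClosure ℤ_[p] F) Q e a →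
        GrossKeating.IsOptimal (integralClosure ℤ_[p] F) (GrossKeating.gram Q e) a →
        GrossKeating.OverlatticeProperty (integralClosure ℤ_[p] F) Q e) ∧
    -- any `p`: an anisotropic lattice over `ℤ_p`, with an optimal (`p` odd) or reduced (`p = 2`)
    -- basis
    (∀ (V : Type*) [AddCommGroup V] [Module ℚ_[p] V] [Module ℤ_[p] V]
        [IsScalarTower ℤ_[p] ℚ_[p] V] (Q : QuadraticForm ℚ_[p] V)
        (m d : ℕ) (e : Module.Basis (Fin (m + d)) ℚ_[p] V) (a : Fin (m + d) → ℕ),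
        GrossKeating.IsLatticeWithLastBlock ℤ_[p] Q e a →
        Q.Anisotropic →
        (p ≠ 2 → GrossKeating.IsOptimal ℤ_[p] (GrossKeating.gram Q e) a) →
        (p = 2 → ∃ σ : Equiv.Perm (Fin (m + d)),
          GrossKeating.IsReducedForm ℤ_[p] (GrossKeating.gram Q e) a σ) →
        GrossKeating.OverlatticeProperty ℤ_[p] Q e) := by
  refine ⟨fun hp F _ _ _ _ _ V _ _ Q m d e a h ha => ?_,
    fun V _ _ _ _ Q m d e a h hQ hodd htwo => ?_⟩
  · refine GrossKeating.overlatticeProperty_of_isOptimal ?_ h ha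
    have := (GrossKeating.isUnit_two_padicInt hp).map (algebraMap ℤ_[p] (integralClosure ℤ_[p] F))
    rwa [map_ofNat] at this
  · refine GrossKeating.overlatticeProperty_of_anisotropic h hQ ?_
    by_cases hp : p = 2
    · obtain ⟨σ, hσ⟩ := htwo hp
      exact hσ.mem
    · exact (hodd hp).2
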